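/- **Setting.** A linear array has $M$ sensors at pairwise distinct positions $\bar d_1d_0,\dots,\bar d_Md_0$ with $\bar d_i\in\mathbb Z$, where $0<d_0\le\lambda/2$ and $\lambda$ is the wavelength. The sources have distinct directions $\theta_1,\dots,\theta_K\in(-\pi/2,\pi/2)$ and powers $p_1,\dots,p_K>0$, and the noise has variance $\sigma^2\ge 0$. With $\phi(\theta)=2\pi d_0\sin\theta/\lambda$, $A=[e^{j\bar d_i\phi(\theta_k)}]_{i,k}$ and $P=\operatorname{diag}(p_1,\dots,p_K)$, the covariance matrix of the array output is $R=APA^H+\sigma^2I$. Let $M_v>K$ be such that every integer $l$ with $|l|<M_v$ is a difference $\bar d_m-\bar d_n$ (the largest such $M_v$ gives the central uniform part of the coarray). Let $a_v(\theta)=[e^{ji\phi(\theta)}]_{0\le i<M_v}$ and $A_v=[a_v(\theta_1)\cdots a_v(\theta_K)]$. Let $\omega(l)$ be the number of pairs $(m,n)$ with $\bar d_m-\bar d_n=l$. The coarray selection matrix $F$ is $(2M_v-1)\times M^2$ with $F_{m,\,p+(q-1)M}=1/\omega(m-M_v)$ if $\bar d_p-\bar d_q=m-M_v$, and $0$ otherwise.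 Let $\Gamma_i=[0_{M_v\times(i-1)}\ I_{M_v}\ 0_{M_v\times(M_v-i)}]$ and $\Gamma=[\Gamma_{M_v}^T\cdots\Gamma_1^T]^T$. For a Hermitian estimate $\hat R$ of $R$ put $\hat z=F\operatorname{vec}(\hat R)$, $\hat z_i=\Gamma_i\hat z$, $\hat R_{v1}=[\hat z_{M_v}\cdots\hat z_1]$ and $\hat R_{v2}=\frac1{M_v}\sum_{i=1}^{M_v}\hat z_i\hat z_i^H$. MUSIC applied to $S=\hat R_{v1}$ (DA-MUSIC) or $S=\hat R_{v2}$ (SS-MUSIC) takes orthonormal eigenvectors $\hat E_n$ of $S$ for its $M_v-K$ smallest eigenvalues, and returns the $K$ deepest local minima in $(-\pi/2,\pi/2)$ of $\theta\mapsto\|\hat E_n^Ha_v(\theta)\|^2$, labelled in the same order as $\theta_1,\dots,\theta_K$. Denote the results by $\hat\theta^{(1)}_k$ and $\hat\theta^{(2)}_k$, respectively. **Theorem.** Let $A_v^\dagger=(A_v^HA_v)^{-1}A_v^H$, $\Pi=I-A_vA_v^\dagger$, $\dot a_k=\frac{\partial a_v}{\partial\theta}(\theta_k)$, and $$\alpha_k^T=-e_k^TA_v^\dagger,\quad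 \beta_k=\Pi\dot a_k,\quad \gamma_k=\dot a_k^H\Pi\dot a_k,\quad \xi_k=F^T\Gamma^T(\beta_k\otimes\alpha_k).$$ Then $\gamma_k>0$ for all $k$. Write $\Delta r=\operatorname{vec}(\hat R-R)$. When $\hat R$ is Hermitian and close enough to $R$ (so that there is no subspace swap), both estimates exist, and, as $\Delta r\to0$ over Hermitian $\hat R$, for every $k$, $$\hat\theta^{(1)}_k-\theta_k\doteq\hat\theta^{(2)}_k-\theta_k\doteq-(\gamma_kp_k)^{-1}\operatorname{Re}(\xi_k^T\Delta r),$$ where $\doteq$ means that the two sides differ by $o(\|\Delta r\|)$. In particular, suppose that the snapshots are $y(t)=Ax(t)+n(t)$, where all the source signals $x_k(t)$ and noise terms $n_m(t)$ are independent and circularly-symmetric complex Gaussian of variances $p_k$ and $\sigma^2$, and let $\hat R=\frac1N\sum_{t=1}^Ny(t)y(t)^H$. Then, almost surely, as $N\to\infty$: $\Delta r\to0$, both estimates exist for all large $N$, and the same relations $\doteq$ hold. -/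

import Mathlib

open Matrix MeasureTheory ProbabilityTheory Filter Topology

noncomputable section

namespace Coarray

/-! ### Arrays, steering vectors and the covariance matrix -/

/-- Electrical angle `φ = 2π d₀ sin θ / λ` of a source in direction `θ`. -/
def phase (d₀ lam θ : ℝ) : ℝ := 2 * Real.pi * d₀ * Real.sin θ / lam

/-- Steering vector of a linear array with sensors at `d i * d₀`, for a source in direction `θ`. -/
def steeringVec {M : ℕ} (d : Fin M → ℤ) (d₀ lam θ : ℝ) : Fin M → ℂ :=
  fun i => Complex.exp (Complex.I * (d i : ℂ) * (phase d₀ lam θ : ℂ))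

/-- Steering matrix, whose `k`-th column is the steering vector of direction `θ k`. -/
def steeringMat {M K : ℕ} (d : Fin M → ℤ) (d₀ lam : ℝ) (θ : Fin K → ℝ) :
    Matrix (Fin M) (Fin K) ℂ :=
  Matrix.of fun i k => steeringVec d d₀ lam (θ k) i

/-- Covariance matrix `R = A P Aᴴ + σ² I` of the array output, with `P = diag p`. -/
def covariance {M K : ℕ} (d : Fin M → ℤ) (d₀ lam : ℝ) (θ p : Fin K → ℝ) (σsq : ℝ) :
    Matrix (Fin M) (Fin M) ℂ :=
  steeringMat d d₀ lam θ * Matrix.diagonal (fun k => (p k : ℂ)) * (steeringMat d d₀ lam θ)ᴴ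
    + (σsq : ℂ) • (1 : Matrix (Fin M) (Fin M) ℂ)

/-- Sensor positions `0, 1, …, Mv - 1` (in units of `d₀`) of the virtual uniform linear array. -/
def ula (Mv : ℕ) : Fin Mv → ℤ := fun i => (i : ℤ)

/-! ### The difference coarray -/

/-- The difference coarray (in units of `d₀`). -/
def coarray {M : ℕ} (d : Fin M → ℤ) : Set ℤ := {l | ∃ m n, d m - d n = l}

/-- The weight function: the number of ordered sensor pairs with difference `l`. -/
def weight {M : ℕ} (d : Fin M → ℤ) (l : ℤ) : ℕ :=
  (Finset.univ.filter fun mn : Fin M × Fin M => d mn.1 - d mn.2 = l).card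

/-- The coarray contains the uniform linear array `-Mv + 1, …, Mv - 1`. The largest such `Mv`
gives the central uniform part of the coarray. -/
def ContainsULA {M : ℕ} (d : Fin M → ℤ) (Mv : ℕ) : Prop :=
  ∀ l : ℤ, |l| < (Mv : ℤ) → l ∈ coarray d

/-- The coarray selection matrix `F`. Rows are indexed from `0`, so row `m` belongs to the
difference `m + 1 - Mv`. Columns are indexed by pairs (column, row) as in `Matrix.vec`. -/
def selMat {M : ℕ} (d : Fin M → ℤ) (Mv : ℕ) :
    Matrix (Fin (2 * Mv - 1)) (Fin M × Fin M) ℂ :=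
  Matrix.of fun m qp =>
    if d qp.2 - d qp.1 = (m : ℤ) + 1 - (Mv : ℤ) then
      1 / (weight d ((m : ℤ) + 1 - (Mv : ℤ)) : ℂ) else 0

/-- Selection matrix of the `i`-th subarray (indexed from `0`): `[0_{Mv × i}  I  0]`. -/
def subSel (Mv : ℕ) (i : Fin Mv) : Matrix (Fin Mv) (Fin (2 * Mv - 1)) ℂ :=
  Matrix.of fun r c => if (c : ℕ) = (i : ℕ) + (r : ℕ) then 1 else 0

/-- The subarray selection matrices stacked in reverse order, last one on top.
The row index is (block, row in the block). -/
def stackSel (Mv : ℕ) : Matrix (Fin Mv × Fin Mv) (Fin (2 * Mv - 1)) ℂ :=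
  Matrix.of fun br c => subSel Mv br.1.rev br.2 c

/-- Observation `z = F vec(R)` of the virtual uniform linear array. -/
def virtualObs {M : ℕ} (d : Fin M → ℤ) (Mv : ℕ) (R : Matrix (Fin M) (Fin M) ℂ) :
    Fin (2 * Mv - 1) → ℂ :=
  selMat d Mv *ᵥ R.vec

/-- Directly augmented covariance matrix: its columns are the subarray outputs in reverse order. -/
def directAug {M : ℕ} (d : Fin M → ℤ) (Mv : ℕ) (R : Matrix (Fin M) (Fin M) ℂ) :
    Matrix (Fin Mv) (Fin Mv) ℂ :=
  Matrix.of fun r c => (subSel Mv c.rev *ᵥ virtualObs d Mv R) r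

/-- Spatially smoothed covariance matrix: `(1 / Mv) ∑ᵢ zᵢ zᵢᴴ` over the subarray outputs `zᵢ`. -/
def spatialSmooth {M : ℕ} (d : Fin M → ℤ) (Mv : ℕ) (R : Matrix (Fin M) (Fin M) ℂ) :
    Matrix (Fin Mv) (Fin Mv) ℂ :=
  (1 / (Mv : ℂ)) • ∑ i : Fin Mv,
    Matrix.vecMulVec (subSel Mv i *ᵥ virtualObs d Mv R)
      (star (subSel Mv i *ᵥ virtualObs d Mv R))

/-! ### MUSIC -/

/-- `S = U diag(Λ) Uᴴ` with `U` unitary and the eigenvalues `Λ` in decreasing order. -/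
structure IsEigendecomp {m : ℕ} (S U : Matrix (Fin m) (Fin m) ℂ) (Λ : Fin m → ℝ) : Prop where
  unitary : U ∈ Matrix.unitaryGroup (Fin m) ℂ
  antitone : Antitone Λ
  eq : S = U * Matrix.diagonal (fun i => (Λ i : ℂ)) * Uᴴ

/-- The MUSIC null spectrum `aᴴ Eₙ Eₙᴴ a = ‖Eₙᴴ a‖²`, where `Eₙ` consists of all columns of `U`
but the first `K`. -/
def nullSpectrum {m : ℕ} (U : Matrix (Fin m) (Fin m) ℂ) (K : ℕ) (a : Fin m → ℂ) : ℝ :=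
  ∑ i ∈ Finset.univ.filter (fun i : Fin m => K ≤ (i : ℕ)), ‖(Uᴴ *ᵥ a) i‖ ^ 2

/-- `est` lists the `K` DOAs that MUSIC finds from the matrix `S` on the virtual uniform linear
array: they are `K` distinct local minimizers, in the field of view `(-π/2, π/2)`, of the null
spectrum (peaks of the pseudo-spectrum), and no other local minimum is deeper. The noise
eigenvectors belong to the `Mv - K` smallest eigenvalues. -/
def IsMusicEstimate {Mv K : ℕ} (d₀ lam : ℝ) (S : Matrix (Fin Mv) (Fin Mv) ℂ)
    (est : Fin K → ℝ) : Prop :=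
  ∃ (U : Matrix (Fin Mv) (Fin Mv) ℂ) (Λ : Fin Mv → ℝ), IsEigendecomp S U Λ ∧
    let f : ℝ → ℝ := fun θ => nullSpectrum U K (steeringVec (ula Mv) d₀ lam θ)
    Function.Injective est ∧
    (∀ k, est k ∈ Set.Ioo (-(Real.pi / 2)) (Real.pi / 2) ∧ IsLocalMin f (est k)) ∧
    ∀ θ' ∈ Set.Ioo (-(Real.pi / 2)) (Real.pi / 2), IsLocalMin f θ' →
      θ' ∉ Set.range est → ∀ k, f (est k) ≤ f θ'

/-- `est` is labelled like the true directions `θ`: both are in the same order. -/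
def SameOrder {K : ℕ} (θ est : Fin K → ℝ) : Prop :=
  ∀ i j, θ i < θ j → est i < est j

/-- DOA estimates by direct augmentation based MUSIC from the covariance estimate `Rhat`. -/
def IsDAMusic {M K : ℕ} (d : Fin M → ℤ) (Mv : ℕ) (d₀ lam : ℝ) (θ : Fin K → ℝ)
    (Rhat : Matrix (Fin M) (Fin M) ℂ) (est : Fin K → ℝ) : Prop :=
  IsMusicEstimate d₀ lam (directAug d Mv Rhat) est ∧ SameOrder θ est

/-- DOA estimates by spatial smoothing based MUSIC from the covariance estimate `Rhat`. -/
def IsSSMusic {M K : ℕ} (d : Fin M → ℤ) (Mv : ℕ) (d₀ lam : ℝ) (θ : Fin K → ℝ)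
    (Rhat : Matrix (Fin M) (Fin M) ℂ) (est : Fin K → ℝ) : Prop :=
  IsMusicEstimate d₀ lam (spatialSmooth d Mv Rhat) est ∧ SameOrder θ est

/-! ### The vectors of the error expression -/

/-- Pseudo-inverse `A† = (Aᴴ A)⁻¹ Aᴴ` of a matrix of full column rank. -/
def pinv {m K : ℕ} (A : Matrix (Fin m) (Fin K) ℂ) : Matrix (Fin K) (Fin m) ℂ :=
  (Aᴴ * A)⁻¹ * Aᴴ

/-- The projection `I - A A†`. -/
def projPerp {m K : ℕ} (A : Matrix (Fin m) (Fin K) ℂ) : Matrix (Fin m) (Fin m) ℂ :=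
  1 - A * pinv A

/-- `αₖᵀ = - eₖᵀ A_v†`. -/
def alpha {K : ℕ} (Mv : ℕ) (d₀ lam : ℝ) (θ : Fin K → ℝ) (k : Fin K) : Fin Mv → ℂ :=
  fun i => - pinv (steeringMat (ula Mv) d₀ lam θ) k i

/-- The derivative of the virtual steering vector with respect to the direction, at `θ`. -/
def steeringDeriv (Mv : ℕ) (d₀ lam θ : ℝ) : Fin Mv → ℂ :=
  deriv (fun t : ℝ => steeringVec (ula Mv) d₀ lam t) θ

/-- `βₖ = Π ȧₖ`, with `Π` the projection onto the orthogonal complement of the range of `A_v`. -/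
def beta {K : ℕ} (Mv : ℕ) (d₀ lam : ℝ) (θ : Fin K → ℝ) (k : Fin K) : Fin Mv → ℂ :=
  projPerp (steeringMat (ula Mv) d₀ lam θ) *ᵥ steeringDeriv Mv d₀ lam (θ k)

/-- `γₖ = ȧₖᴴ Π ȧₖ`; the quadratic form of a Hermitian matrix is real. -/
def gamma {K : ℕ} (Mv : ℕ) (d₀ lam : ℝ) (θ : Fin K → ℝ) (k : Fin K) : ℝ :=
  (star (steeringDeriv Mv d₀ lam (θ k)) ⬝ᵥ
    (projPerp (steeringMat (ula Mv) d₀ lam θ) *ᵥ steeringDeriv Mv d₀ lam (θ k))).re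

/-- Kronecker product of two column vectors. -/
def kronVec {m n : ℕ} (u : Fin m → ℂ) (v : Fin n → ℂ) : Fin m × Fin n → ℂ :=
  fun ij => u ij.1 * v ij.2

/-- `ξₖ = Fᵀ Γᵀ (βₖ ⊗ αₖ)`. -/
def xi {M K : ℕ} (d : Fin M → ℤ) (Mv : ℕ) (d₀ lam : ℝ) (θ : Fin K → ℝ) (k : Fin K) :
    Fin M × Fin M → ℂ :=
  (selMat d Mv)ᵀ *ᵥ ((stackSel Mv)ᵀ *ᵥ kronVec (beta Mv d₀ lam θ k) (alpha Mv d₀ lam θ k))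

/-- The first-order error `-(γₖ pₖ)⁻¹ Re(ξₖᵀ Δr)`. -/
def firstOrderError {M K : ℕ} (d : Fin M → ℤ) (Mv : ℕ) (d₀ lam : ℝ) (θ p : Fin K → ℝ)
    (k : Fin K) (Δr : Fin M × Fin M → ℂ) : ℝ :=
  -(gamma Mv d₀ lam θ k * p k)⁻¹ * (xi d Mv d₀ lam θ k ⬝ᵥ Δr).re

/-- Asymptotic equality to first order in `δ` along `l`: the difference is `o(‖δ‖)`. -/
def FirstOrderEq {ι E : Type*} [Norm E] (l : Filter ι) (δ : ι → E) (f g : ι → ℝ) : Prop :=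
  (fun i => f i - g i) =o[l] δ

/-! ### Snapshots -/

/-- The circularly-symmetric complex Gaussian law of variance `v`: independent real and imaginary
parts, each centred of variance `v / 2`. -/
def circGaussian (v : ℝ) : Measure ℂ :=
  ((gaussianReal 0 (v / 2).toNNReal).prod (gaussianReal 0 (v / 2).toNNReal)).map
    fun w : ℝ × ℝ => (w.1 : ℂ) + (w.2 : ℂ) * Complex.I

/-- The unconditional signal model: the source signals `x t k` and the noise `n t m` are
circularly-symmetric Gaussian of variances `p k` and `σsq`, and all of them, over sources, sensors
and snapshots, are independent (for jointly Gaussian variables: uncorrelated). -/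
structure IsSnapshotModel {Ω : Type*} [MeasurableSpace Ω] (μ : Measure Ω) {M K : ℕ}
    (p : Fin K → ℝ) (σsq : ℝ) (x : ℕ → Fin K → Ω → ℂ) (n : ℕ → Fin M → Ω → ℂ) : Prop where
  source_law : ∀ t k, HasLaw (x t k) (circGaussian (p k)) μ
  noise_law : ∀ t m, HasLaw (n t m) (circGaussian σsq) μ
  indep : iIndepFun (fun i : ℕ × (Fin K ⊕ Fin M) => Sum.elim (x i.1) (n i.1) i.2) μ

/-- The snapshot `y(t) = A x(t) + n(t)`. -/
def snapshot {Ω : Type*} {M K : ℕ} (d : Fin M → ℤ) (d₀ lam : ℝ) (θ : Fin K → ℝ)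
    (x : ℕ → Fin K → Ω → ℂ) (n : ℕ → Fin M → Ω → ℂ) (t : ℕ) (ω : Ω) : Fin M → ℂ :=
  (steeringMat d d₀ lam θ *ᵥ fun k => x t k ω) + fun m => n t m ω

/-- The sample covariance matrix `(1 / N) ∑ y(t) y(t)ᴴ` of the first `N` snapshots. -/
def sampleCov {Ω : Type*} {M K : ℕ} (d : Fin M → ℤ) (d₀ lam : ℝ) (θ : Fin K → ℝ)
    (x : ℕ → Fin K → Ω → ℂ) (n : ℕ → Fin M → Ω → ℂ) (N : ℕ) (ω : Ω) :
    Matrix (Fin M) (Fin M) ℂ :=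
  (1 / (N : ℂ)) • ∑ t ∈ Finset.range N,
    Matrix.vecMulVec (snapshot d d₀ lam θ x n t ω) (star (snapshot d d₀ lam θ x n t ω))

end Coarray

end

open Coarray

/-!
The proof is a first-order perturbation analysis of the noise projector followed by a critical
point analysis of the null spectrum.

Let `A` be the steering matrix of the virtual uniform linear array, `Π` the projector onto the
orthogonal complement of its range, `P = diag p`, and `E` the augmented matrix of `R̂ - R`. Direct
augmentation is linear and maps `R` to `A P Aᴴ + σ² I` (`directAug_covariance`), so DA-MUSIC works
with `A P Aᴴ + σ² I + E`. For Hermitian `R̂` this matrix is Hermitian and spatial smoothing yields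
exactly its square, up to the factor `1 / Mv` (`smul_spatialSmooth`).

Let `Q̂` be the noise projector of a Hermitian matrix `A G Aᴴ + c I + E`. By Weyl's inequality the
noise eigenvalues are within `O(E)` of `c`, and `Q̂` commutes with the matrix. This alone gives
`Q̂ A G + Q̂ E A†ᴴ = O(E²)` and, as projectors of equal rank are compared, `Q̂ - Π = O(E)`
(`noiseProj_perturbation`). For the square, `G` and the perturbation acquire the same invertible
factor, which cancels (`noiseProj_perturbation_of_sq`). So in both cases
`Q̂ A P = -Π E A†ᴴ + O(E²)`, which is why the two estimators agree to first order.

The null spectrum `a(θ)ᴴ Q a(θ)` depends smoothly on `(Q, θ)`. For `Q = Π` its zeros on the closed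
field of view are the `θ k`, with second derivative `2 γ k > 0`. Both facts hold because
`K < Mv`: the coefficient vector of the polynomial of degree `K` with the nodes `e^{jφ(θ k)}` as its
roots annihilates the columns of `A`, but no other steering vector and none of the derivatives `ȧₖ`.
Hence, for `Q` near `Π`, there is one deep
local minimum near each `θ k` and the other local minima are higher (`eventually_deepestMinima`).
The mean value theorem for the derivative of the null spectrum then gives the error
`-2 Re(ȧᴴ Q̂ a) / (2 γ)` (`isLittleO_critical_point_sub`), into which the expansion of `Q̂ A` is
inserted.

All of this is carried out along an arbitrary filter (`estimates_asymptotics`). It is applied to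
`R̂ → R` and, by the strong law of large numbers (`ae_tendsto_sampleCov`), to the sample covariance
matrices.
-/

open Asymptotics

namespace Coarray

/-! ### Entrywise asymptotics of matrix families -/

section EntryBigO

variable {ι m n k : Type*} {l : Filter ι} {e f : ι → ℝ}

/-- A family of matrices is `O(e)` along `l` if each of its entries is. Working entrywise avoids
fixing a norm and allows rectangular products. -/
def EntryBigO (l : Filter ι) (X : ι → Matrix m n ℂ) (e : ι → ℝ) : Prop :=
  ∀ i j, (fun t => X t i j) =O[l] e

namespace EntryBigO

variable {X Y : ι → Matrix m n ℂ}

lemma add (hX : EntryBigO l X e) (hY : EntryBigO l Y e) :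
    EntryBigO l (fun t => X t + Y t) e := fun i j => (hX i j).add (hY i j)

lemma sub (hX : EntryBigO l X e) (hY : EntryBigO l Y e) :
    EntryBigO l (fun t => X t - Y t) e := fun i j => (hX i j).sub (hY i j)

lemma congr (hX : EntryBigO l X e) (h : ∀ᶠ t in l, X t = Y t) : EntryBigO l Y e := fun i j =>
  (hX i j).congr' (h.mono fun t ht => by simp only [ht]) EventuallyEq.rfl

lemma const (C : Matrix m n ℂ) : EntryBigO l (fun _ => C) (fun _ => 1) := fun _ _ =>
  isBigO_const_const _ one_ne_zero _

lemma mul [Fintype n] {Z : ι → Matrix n k ℂ} (hX : EntryBigO l X e) (hZ : EntryBigO l Z f) :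
    EntryBigO l (fun t => X t * Z t) (fun t => e t * f t) := fun i j => by
  simp only [Matrix.mul_apply]
  exact IsBigO.fun_sum fun r _ => (hX i r).mul (hZ r j)

lemma mul_const [Fintype n] (hX : EntryBigO l X e) (C : Matrix n k ℂ) :
    EntryBigO l (fun t => X t * C) e := by
  simpa using hX.mul (const C)

lemma const_mul [Fintype m] (hX : EntryBigO l X e) (C : Matrix k m ℂ) :
    EntryBigO l (fun t => C * X t) e := by
  simpa using (const (l := l) C).mul hX

lemma conjTranspose (hX : EntryBigO l X e) : EntryBigO l (fun t => (X t)ᴴ) e := fun i j => by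
  refine IsBigO.congr_left (f₁ := fun t => star (X t j i)) ?_ fun t => rfl
  exact (isBigO_norm_left.1 (by simpa only [norm_star] using (hX j i).norm_left))

lemma trans (hX : EntryBigO l X e) (h : e =O[l] f) : EntryBigO l X f := fun i j =>
  (hX i j).trans h

end EntryBigO

end EntryBigO

/-! ### The noise projector -/

section NoiseProj

variable {m K : ℕ}

/-- The orthogonal projector `Eₙ Eₙᴴ` onto the span of all columns of `U` but the first `K`. -/
def noiseProj (U : Matrix (Fin m) (Fin m) ℂ) (K : ℕ) : Matrix (Fin m) (Fin m) ℂ :=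
  U * diagonal (fun i : Fin m => if K ≤ (i : ℕ) then 1 else 0) * Uᴴ

lemma re_star_dotProduct_self {n : Type*} [Fintype n] (v : n → ℂ) :
    (star v ⬝ᵥ v).re = ∑ i, ‖v i‖ ^ 2 := by
  simp [dotProduct, ← Complex.normSq_eq_norm_sq, Complex.normSq_apply]

lemma star_mulVec_dotProduct {n n' : Type*} [Fintype n] [Fintype n'] (A : Matrix n n' ℂ)
    (v : n' → ℂ) (w : n → ℂ) : star (A *ᵥ v) ⬝ᵥ w = star v ⬝ᵥ (Aᴴ *ᵥ w) := by
  rw [star_mulVec, ← dotProduct_mulVec]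

lemma nullSpectrum_eq (U : Matrix (Fin m) (Fin m) ℂ) (K : ℕ) (a : Fin m → ℂ) :
    nullSpectrum U K a = (star a ⬝ᵥ (noiseProj U K *ᵥ a)).re := by
  have : star a ⬝ᵥ (noiseProj U K *ᵥ a) = star (Uᴴ *ᵥ a) ⬝ᵥ
      (diagonal (fun i : Fin m => if K ≤ (i : ℕ) then 1 else 0) *ᵥ (Uᴴ *ᵥ a)) := by
    rw [star_mulVec_dotProduct, conjTranspose_conjTranspose, noiseProj, mulVec_mulVec,
      mulVec_mulVec]
  rw [this, nullSpectrum, Finset.sum_filter, dotProduct, Complex.re_sum]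
  refine Finset.sum_congr rfl fun i _ => ?_
  rw [mulVec_diagonal]
  split_ifs <;> simp [← Complex.normSq_eq_norm_sq, Complex.normSq_apply]

lemma noiseProj_isHermitian (U : Matrix (Fin m) (Fin m) ℂ) (K : ℕ) :
    (noiseProj U K).IsHermitian := by
  rw [noiseProj, IsHermitian, conjTranspose_mul, conjTranspose_mul, conjTranspose_conjTranspose,
    diagonal_conjTranspose, Matrix.mul_assoc]
  congr 3
  ext i
  simp [apply_ite]

variable {U : Matrix (Fin m) (Fin m) ℂ}

lemma conj_diagonal_mul (hU : U ∈ unitaryGroup (Fin m) ℂ) (a b : Fin m → ℂ) :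
    (U * diagonal a * Uᴴ) * (U * diagonal b * Uᴴ) = U * diagonal (fun i => a i * b i) * Uᴴ := by
  have h : Uᴴ * U = 1 := mem_unitaryGroup_iff'.1 hU
  calc _ = U * diagonal a * (Uᴴ * U) * diagonal b * Uᴴ := by simp only [Matrix.mul_assoc]
    _ = _ := by rw [h, Matrix.mul_one, Matrix.mul_assoc U, diagonal_mul_diagonal]

lemma noiseProj_mul_self (hU : U ∈ unitaryGroup (Fin m) ℂ) (K : ℕ) :
    noiseProj U K * noiseProj U K = noiseProj U K := by
  rw [noiseProj, conj_diagonal_mul hU]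
  congr 3
  ext i
  split_ifs <;> simp

lemma trace_noiseProj (hU : U ∈ unitaryGroup (Fin m) ℂ) (hK : K ≤ m) :
    (noiseProj U K).trace = (m : ℂ) - K := by
  rw [noiseProj, trace_mul_comm, ← Matrix.mul_assoc,
    show Uᴴ * U = 1 from mem_unitaryGroup_iff'.1 hU, Matrix.one_mul, trace_diagonal, Finset.sum_boole]
  have h : (Finset.univ.filter fun i : Fin m => K ≤ (i : ℕ)).card = m - K := by
    have h1 := Finset.card_filter_add_card_filter_not (s := (Finset.univ : Finset (Fin m)))
      (fun i : Fin m => (i : ℕ) < K)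
    have h2 : (Finset.univ.filter fun i : Fin m => (i : ℕ) < K).card = K := by
      rw [Fin.card_filter_val_lt, min_eq_right hK]
    simp only [not_lt, Finset.card_univ, Fintype.card_fin] at h1
    omega
  rw [h, Nat.cast_sub hK]

/-! ### Weyl's inequality for the noise eigenvalues -/

lemma abs_re_quadForm_le {n : Type*} [Fintype n] (E : Matrix n n ℂ) (v : n → ℂ) :
    |(star v ⬝ᵥ (E *ᵥ v)).re| ≤ (∑ i, ∑ j, ‖E i j‖) * ∑ i, ‖v i‖ ^ 2 := by
  have hle : ∀ i, ‖v i‖ ^ 2 ≤ ∑ i, ‖v i‖ ^ 2 := fun i =>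
    Finset.single_le_sum (f := fun i => ‖v i‖ ^ 2) (fun _ _ => sq_nonneg _) (Finset.mem_univ i)
  refine (Complex.abs_re_le_norm _).trans ?_
  generalize ∑ i, ‖v i‖ ^ 2 = N at hle
  simp only [dotProduct, mulVec, Finset.mul_sum, Finset.sum_mul]
  refine (norm_sum_le _ _).trans (Finset.sum_le_sum fun i _ => (norm_sum_le _ _).trans
    (Finset.sum_le_sum fun j _ => ?_))
  rw [norm_mul, norm_mul, Pi.star_apply, norm_star]
  have : ‖v i‖ * ‖v j‖ ≤ N := by nlinarith [sq_nonneg (‖v i‖ - ‖v j‖), hle i, hle j]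
  calc _ = ‖E i j‖ * (‖v i‖ * ‖v j‖) := by ring
    _ ≤ _ := by gcongr

variable {S : Matrix (Fin m) (Fin m) ℂ} {Λ : Fin m → ℝ}

lemma IsEigendecomp.quadForm (h : IsEigendecomp S U Λ) (w : Fin m → ℂ) :
    (star (U *ᵥ w) ⬝ᵥ (S *ᵥ (U *ᵥ w))).re = ∑ i, Λ i * ‖w i‖ ^ 2 := by
  have hU : Uᴴ * U = 1 := mem_unitaryGroup_iff'.1 h.unitary
  have : Uᴴ * S * U = diagonal (fun i => (Λ i : ℂ)) := by
    rw [h.eq]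
    calc _ = (Uᴴ * U) * diagonal (fun i => (Λ i : ℂ)) * (Uᴴ * U) := by
          simp only [Matrix.mul_assoc]
      _ = _ := by rw [hU, Matrix.one_mul, Matrix.mul_one]
  rw [star_mulVec_dotProduct, mulVec_mulVec, mulVec_mulVec, this,
    dotProduct, Complex.re_sum]
  refine Finset.sum_congr rfl fun i _ => ?_
  rw [mulVec_diagonal, ← Complex.normSq_eq_norm_sq, Complex.normSq_apply]
  simp
  ring

lemma IsEigendecomp.sum_norm_sq (h : IsEigendecomp S U Λ) (w : Fin m → ℂ) :
    ∑ i, ‖(U *ᵥ w) i‖ ^ 2 = ∑ i, ‖w i‖ ^ 2 := by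
  rw [← re_star_dotProduct_self, star_mulVec_dotProduct, mulVec_mulVec,
    show Uᴴ * U = 1 from mem_unitaryGroup_iff'.1 h.unitary, one_mulVec, re_star_dotProduct_self]

/-- Weyl's inequality for the smallest `m - K` eigenvalues of `A G Aᴴ + c I + E`, with the sum of
the moduli of the entries of `E` as a bound for its operator norm. The upper bound holds because
`K` linear conditions `Aᴴ v = 0` have a solution in the span of any `K + 1` eigenvectors. -/
lemma IsEigendecomp.abs_eigenvalue_sub_le (h : IsEigendecomp S U Λ)
    {A : Matrix (Fin m) (Fin K) ℂ} {G : Matrix (Fin K) (Fin K) ℂ} {c : ℝ}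
    {E : Matrix (Fin m) (Fin m) ℂ} (hG : ∀ w, 0 ≤ (star w ⬝ᵥ (G *ᵥ w)).re)
    (hS : S = A * G * Aᴴ + (c : ℂ) • (1 : Matrix (Fin m) (Fin m) ℂ) + E)
    (i : Fin m) (hi : K ≤ (i : ℕ)) : |Λ i - c| ≤ ∑ i, ∑ j, ‖E i j‖ := by
  set η := ∑ i, ∑ j, ‖E i j‖
  have key : ∀ v : Fin m → ℂ, (star v ⬝ᵥ (S *ᵥ v)).re =
      (star v ⬝ᵥ ((A * G * Aᴴ) *ᵥ v)).re + c * ∑ i, ‖v i‖ ^ 2 + (star v ⬝ᵥ (E *ᵥ v)).re := by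
    intro v
    rw [hS, add_mulVec, add_mulVec, smul_mulVec, one_mulVec, dotProduct_add, dotProduct_add,
      dotProduct_smul, Complex.add_re, Complex.add_re, smul_eq_mul, Complex.re_ofReal_mul,
      re_star_dotProduct_self]
  have hE := fun v => abs_le.1 (abs_re_quadForm_le E v)
  rw [abs_le]
  constructor
  · have h1 := h.quadForm (Pi.single i 1)
    have h2 := h.sum_norm_sq (Pi.single i 1)
    have h3 := key (U *ᵥ Pi.single i 1)
    have h4 := hG (Aᴴ *ᵥ (U *ᵥ Pi.single i 1))
    rw [star_mulVec_dotProduct, conjTranspose_conjTranspose, mulVec_mulVec, mulVec_mulVec,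
      Matrix.mul_assoc A, ← Matrix.mul_assoc] at h4
    have h5 := (hE (U *ᵥ Pi.single i 1)).1
    have h6 : ∑ j, ‖(Pi.single i 1 : Fin m → ℂ) j‖ ^ 2 = 1 := by
      rw [Finset.sum_eq_single i] <;> simp +contextual
    have h7 : ∑ j, Λ j * ‖(Pi.single i 1 : Fin m → ℂ) j‖ ^ 2 = Λ i := by
      rw [Finset.sum_eq_single i] <;> simp +contextual
    rw [h2, h6] at h3 h5
    rw [h7] at h1
    linarith
  · let T : Matrix (Fin K) (Fin (i + 1)) ℂ := Matrix.of fun r s =>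
      (Aᴴ * U) r (Fin.castLE i.2 s)
    obtain ⟨w, hw, hw0⟩ : ∃ w ∈ LinearMap.ker T.mulVecLin, w ≠ 0 := by
      refine (Submodule.ne_bot_iff _).1 (LinearMap.ker_ne_bot_of_finrank_lt ?_)
      simp
      omega
    rw [LinearMap.mem_ker, mulVecLin_apply] at hw
    let w' : Fin m → ℂ := fun j => if hj : j ≤ i then w ⟨j, Nat.lt_succ_of_le hj⟩ else 0
    have hsum : ∀ {β : Type} [AddCommMonoid β] (g : Fin m → ℂ → β), (∀ j, g j 0 = 0) →
        ∑ j, g j (w' j) = ∑ s : Fin (i + 1), g (Fin.castLE i.2 s) (w s) := by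
      intro β _ g hg
      symm
      refine Finset.sum_of_injOn (Fin.castLE i.2) (Fin.castLE_injective _).injOn (by simp) ?_ ?_
      · intro j _ hj
        have : ¬ j ≤ i := fun h => hj ⟨⟨j, Nat.lt_succ_of_le h⟩, by simp, by ext; simp⟩
        simp only [w', this, dite_false, hg]
      · intro s _
        have : Fin.castLE i.2 s ≤ i := Nat.le_of_lt_succ s.2
        simp [w', this]
    have hA : Aᴴ *ᵥ (U *ᵥ w') = 0 := by
      rw [mulVec_mulVec]
      ext r
      have := congrFun hw r
      rw [mulVec, dotProduct, hsum (fun j z => (Aᴴ * U) r j * z) (by simp)]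
      simpa [mulVec, dotProduct, T] using this
    have hpos : 0 < ∑ j, ‖w' j‖ ^ 2 := by
      rw [hsum (fun _ z => ‖z‖ ^ 2) (by simp)]
      obtain ⟨s, hs⟩ := Function.ne_iff.1 hw0
      exact Finset.sum_pos' (fun _ _ => sq_nonneg _)
        ⟨s, Finset.mem_univ _, by have := norm_pos_iff.2 hs; positivity⟩
    have h1 := h.quadForm w'
    have h2 := h.sum_norm_sq w'
    have h3 := key (U *ᵥ w')
    have h4 : (star (U *ᵥ w') ⬝ᵥ ((A * G * Aᴴ) *ᵥ (U *ᵥ w'))).re = 0 := by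
      rw [← mulVec_mulVec, hA]
      simp
    have h5 := (hE (U *ᵥ w')).2
    have h6 : Λ i * ∑ j, ‖w' j‖ ^ 2 ≤ ∑ j, Λ j * ‖w' j‖ ^ 2 := by
      rw [Finset.mul_sum]
      refine Finset.sum_le_sum fun j _ => ?_
      by_cases hj : j ≤ i
      · gcongr
        exact h.antitone hj
      · simp [w', hj]
    rw [h2] at h3 h5
    rw [h4] at h3
    have : (Λ i - c) * ∑ j, ‖w' j‖ ^ 2 ≤ η * ∑ j, ‖w' j‖ ^ 2 := by linarith
    exact le_of_mul_le_mul_right this hpos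

end NoiseProj

/-! ### First-order perturbation of the noise projector -/

section Perturbation

variable {m K : ℕ} {A : Matrix (Fin m) (Fin K) ℂ}

lemma pinv_mul_self (hA : IsUnit (Aᴴ * A)) : pinv A * A = 1 := by
  rw [pinv, Matrix.mul_assoc, nonsing_inv_mul _ ((isUnit_iff_isUnit_det _).1 hA)]

lemma conjTranspose_pinv (A : Matrix (Fin m) (Fin K) ℂ) : (pinv A)ᴴ = A * (Aᴴ * A)⁻¹ := by
  rw [pinv, conjTranspose_mul, conjTranspose_conjTranspose, conjTranspose_nonsing_inv,
    conjTranspose_mul, conjTranspose_conjTranspose]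

lemma conjTranspose_mul_conjTranspose_pinv (hA : IsUnit (Aᴴ * A)) : Aᴴ * (pinv A)ᴴ = 1 := by
  rw [← conjTranspose_mul, pinv_mul_self hA, conjTranspose_one]

lemma conjTranspose_pinv_mul (hA : IsUnit (Aᴴ * A)) : (pinv A)ᴴ * (Aᴴ * A) = A := by
  rw [conjTranspose_pinv, Matrix.mul_assoc, nonsing_inv_mul _ ((isUnit_iff_isUnit_det _).1 hA),
    Matrix.mul_one]

lemma projPerp_isHermitian (A : Matrix (Fin m) (Fin K) ℂ) : (projPerp A).IsHermitian := by
  rw [projPerp, IsHermitian, conjTranspose_sub, conjTranspose_one, conjTranspose_mul,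
    conjTranspose_pinv, pinv, Matrix.mul_assoc]

lemma projPerp_mul (hA : IsUnit (Aᴴ * A)) : projPerp A * A = 0 := by
  rw [projPerp, Matrix.sub_mul, Matrix.one_mul, Matrix.mul_assoc, pinv_mul_self hA,
    Matrix.mul_one, sub_self]

lemma projPerp_mul_self (hA : IsUnit (Aᴴ * A)) : projPerp A * projPerp A = projPerp A := by
  nth_rw 2 [projPerp]
  rw [Matrix.mul_sub, Matrix.mul_one, ← Matrix.mul_assoc, projPerp_mul hA, Matrix.zero_mul,
    sub_zero]

lemma trace_projPerp (hA : IsUnit (Aᴴ * A)) : (projPerp A).trace = (m : ℂ) - K := by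
  rw [projPerp, trace_sub, trace_mul_comm, pinv_mul_self hA]
  simp

/-- Two orthogonal projectors of equal rank satisfy `‖P - Q‖² = 2 ‖P (1 - Q)‖²` in the Frobenius
norm, so it suffices to bound `P (1 - Q)`. -/
lemma sum_norm_sq_sub_of_projections {P Q : Matrix (Fin m) (Fin m) ℂ} (hP : P.IsHermitian)
    (hQ : Q.IsHermitian) (hP2 : P * P = P) (hQ2 : Q * Q = Q) (htr : P.trace = Q.trace) :
    ∑ i, ∑ j, ‖(P - Q) i j‖ ^ 2 = 2 * ∑ i, ∑ j, ‖(P * (1 - Q)) i j‖ ^ 2 := by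
  have hfrob : ∀ Z : Matrix (Fin m) (Fin m) ℂ,
      ∑ i, ∑ j, ‖Z i j‖ ^ 2 = (Z * Zᴴ).trace.re := by
    intro Z
    simp [Matrix.trace, Matrix.mul_apply, ← Complex.normSq_eq_norm_sq, Complex.normSq_apply]
  rw [hfrob, hfrob]
  have h1 : (P - Q) * (P - Q)ᴴ = P + Q - P * Q - Q * P := by
    rw [conjTranspose_sub, hP.eq, hQ.eq, Matrix.sub_mul, Matrix.mul_sub, Matrix.mul_sub, hP2, hQ2]
    abel
  have h2 : P * (1 - Q) * (P * (1 - Q))ᴴ = P - P * Q * P := by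
    rw [conjTranspose_mul, conjTranspose_sub, hP.eq, hQ.eq, conjTranspose_one]
    have : (1 - Q) * (1 - Q) = 1 - Q := by
      rw [Matrix.sub_mul, Matrix.mul_sub, Matrix.mul_sub, hQ2]
      simp
    calc _ = P * ((1 - Q) * (1 - Q)) * P := by simp only [Matrix.mul_assoc]
      _ = P * P - P * Q * P := by rw [this, Matrix.mul_sub, Matrix.sub_mul, Matrix.mul_one]
      _ = _ := by rw [hP2]
  have h3 : (P * Q * P).trace = (P * Q).trace := by
    rw [trace_mul_comm, ← Matrix.mul_assoc, hP2]
  rw [h1, h2, trace_sub, trace_sub, trace_add, trace_sub, h3, trace_mul_comm Q P, htr]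
  simp
  ring

variable {ι : Type*} {l : Filter ι} {e : ι → ℝ} {U : ι → Matrix (Fin m) (Fin m) ℂ}

lemma entryBigO_of_unitary (hU : ∀ᶠ t in l, U t ∈ unitaryGroup (Fin m) ℂ) :
    EntryBigO l U (fun _ => 1) := fun i j =>
  IsBigO.of_bound 1 (hU.mono fun t ht => by simpa using entry_norm_bound_of_unitary ht i j)

lemma entryBigO_noiseProj (hU : ∀ᶠ t in l, U t ∈ unitaryGroup (Fin m) ℂ) :
    EntryBigO l (fun t => noiseProj (U t) K) (fun _ => 1) := by
  have h := entryBigO_of_unitary hU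
  simpa [noiseProj] using (h.mul_const (diagonal fun i : Fin m => if K ≤ (i : ℕ) then 1 else 0)).mul
    h.conjTranspose

/-- First-order perturbation of the noise projector `Q̂` of `A G Aᴴ + c I + E`. Since `Q̂` commutes
with the matrix and the noise eigenvalues stay within `O(E)` of `c`, the matrix
`N = Q̂ (A G Aᴴ + E)` is `O(E)` and satisfies `N = N Q̂`. Multiplying by `A†ᴴ` on the right gives
`Q̂ A G + Q̂ E A†ᴴ = N Q̂ A†ᴴ`, which is of second order because `Q̂ A` is of first order. No
spectral gap enters. -/
theorem noiseProj_perturbation (hK : K ≤ m) (hA : IsUnit (Aᴴ * A))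
    {G G' : Matrix (Fin K) (Fin K) ℂ} (hGG' : G * G' = 1)
    (hG : ∀ w, 0 ≤ (star w ⬝ᵥ (G *ᵥ w)).re) {c : ℝ} {E : ι → Matrix (Fin m) (Fin m) ℂ}
    (hE : EntryBigO l E e) {Λ : ι → Fin m → ℝ}
    (hdec : ∀ᶠ t in l, IsEigendecomp
      (A * G * Aᴴ + (c : ℂ) • (1 : Matrix (Fin m) (Fin m) ℂ) + E t) (U t) (Λ t)) :
    EntryBigO l (fun t => noiseProj (U t) K * A) e ∧
    EntryBigO l (fun t => noiseProj (U t) K - projPerp A) e ∧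
    EntryBigO l (fun t => noiseProj (U t) K * A * G + noiseProj (U t) K * E t * (pinv A)ᴴ)
      (fun t => e t * e t) := by
  have hU : ∀ᶠ t in l, U t ∈ unitaryGroup (Fin m) ℂ := hdec.mono fun t ht => ht.unitary
  have hQ1 : EntryBigO l (fun t => noiseProj (U t) K) (fun _ => 1) := entryBigO_noiseProj hU
  let N : ι → Matrix (Fin m) (Fin m) ℂ := fun t =>
    U t * diagonal (fun i : Fin m => if K ≤ (i : ℕ) then (Λ t i : ℂ) - c else 0) * (U t)ᴴ
  have hη : (fun t => ∑ i, ∑ j, ‖E t i j‖) =O[l] e :=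
    IsBigO.fun_sum fun i _ => IsBigO.fun_sum fun j _ => (hE i j).norm_left
  have hN : EntryBigO l N e := by
    have hD : EntryBigO l (fun t => diagonal
        (fun i : Fin m => if K ≤ (i : ℕ) then (Λ t i : ℂ) - c else 0)) e := by
      intro i j
      by_cases hij : i = j
      · subst hij
        by_cases hi : K ≤ (i : ℕ)
        · simp only [diagonal_apply_eq, hi, if_true]
          refine (IsBigO.of_bound 1 (hdec.mono fun t ht => ?_)).trans hη
          have := ht.abs_eigenvalue_sub_le hG rfl i hi
          rw [← Complex.ofReal_sub, Complex.norm_real, one_mul]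
          exact this.trans (le_abs_self _)
        · simp only [diagonal_apply_eq, hi, if_false]
          exact isBigO_zero _ _
      · simp only [diagonal_apply_ne _ hij]
        exact isBigO_zero _ _
    have h := entryBigO_of_unitary hU
    simpa using (h.mul hD).mul h.conjTranspose
  have hQN : ∀ᶠ t in l, noiseProj (U t) K * (A * G * Aᴴ + E t) = N t := by
    filter_upwards [hdec] with t ht
    have h1 : A * G * Aᴴ + E t = U t * diagonal (fun i => (Λ t i : ℂ) - c) * (U t)ᴴ := by
      have h2 : (c : ℂ) • (1 : Matrix (Fin m) (Fin m) ℂ) =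
          U t * diagonal (fun _ => (c : ℂ)) * (U t)ᴴ := by
        rw [← smul_one_eq_diagonal, Matrix.mul_smul, Matrix.mul_one, Matrix.smul_mul,
          show U t * (U t)ᴴ = 1 from mem_unitaryGroup_iff.1 ht.unitary]
      have h3 : diagonal (fun i => (Λ t i : ℂ) - c) =
          diagonal (fun i => (Λ t i : ℂ)) - diagonal (fun _ => (c : ℂ)) := by
        rw [diagonal_sub]
      rw [h3, Matrix.mul_sub, Matrix.sub_mul, ← ht.eq, ← h2]
      abel
    rw [h1, noiseProj, conj_diagonal_mul ht.unitary]
    simp only [N, ite_mul, one_mul, zero_mul]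
  have hNQ : ∀ᶠ t in l, N t * noiseProj (U t) K = N t := by
    filter_upwards [hU] with t ht
    simp only [N, noiseProj, conj_diagonal_mul ht, mul_ite, mul_one, mul_zero]
    congr 3
    ext i
    split_ifs <;> rfl
  have hid : ∀ᶠ t in l, noiseProj (U t) K * A * G + noiseProj (U t) K * E t * (pinv A)ᴴ =
      N t * (pinv A)ᴴ := by
    filter_upwards [hQN] with t ht
    rw [← ht, Matrix.mul_add, Matrix.add_mul]
    congr 1
    calc _ = noiseProj (U t) K * A * G * (Aᴴ * (pinv A)ᴴ) := by
          rw [conjTranspose_mul_conjTranspose_pinv hA, Matrix.mul_one]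
      _ = _ := by simp only [Matrix.mul_assoc]
  have hQA : EntryBigO l (fun t => noiseProj (U t) K * A) e := by
    have h1 : EntryBigO l (fun t => noiseProj (U t) K * E t * (pinv A)ᴴ) e := by
      simpa using (hQ1.mul hE).mul_const (pinv A)ᴴ
    have h2 := (((hN.mul_const (pinv A)ᴴ).sub h1).mul_const G')
    refine h2.congr (hid.mono fun t ht => ?_)
    rw [← ht, add_sub_cancel_right, Matrix.mul_assoc, hGG', Matrix.mul_one]
  refine ⟨hQA, ?_, ?_⟩
  · have h1 : EntryBigO l (fun t => noiseProj (U t) K * (1 - projPerp A)) e := by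
      refine (hQA.mul_const (pinv A)).congr (Eventually.of_forall fun t => ?_)
      rw [projPerp, sub_sub_cancel, Matrix.mul_assoc]
    have h2 : (fun t => √(2 * ∑ i, ∑ j, ‖(noiseProj (U t) K * (1 - projPerp A)) i j‖ ^ 2))
        =O[l] e := by
      have h3 : (fun t => √(2 * ∑ i, ∑ j, ‖(noiseProj (U t) K * (1 - projPerp A)) i j‖ ^ 2))
          =O[l] fun t => ∑ i, ∑ j, ‖(noiseProj (U t) K * (1 - projPerp A)) i j‖ := by
        refine IsBigO.of_bound (√2) (Eventually.of_forall fun t => ?_)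
        set Z := noiseProj (U t) K * (1 - projPerp A)
        have h0 : 0 ≤ ∑ i, ∑ j, ‖Z i j‖ :=
          Finset.sum_nonneg fun i _ => Finset.sum_nonneg fun j _ => norm_nonneg _
        rw [Real.norm_of_nonneg (Real.sqrt_nonneg _), Real.norm_of_nonneg h0,
          Real.sqrt_mul (by norm_num)]
        gcongr
        refine Real.sqrt_le_iff.2 ⟨h0, ?_⟩
        rw [← Fintype.sum_prod_type', ← Fintype.sum_prod_type' (f := fun i j => ‖Z i j‖)]
        exact Finset.sum_sq_le_sq_sum_of_nonneg fun i _ => norm_nonneg _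
      exact h3.trans (IsBigO.fun_sum fun i _ => IsBigO.fun_sum fun j _ => (h1 i j).norm_left)
    refine fun i j => (IsBigO.of_bound 1 (hU.mono fun t ht => ?_)).trans h2
    rw [one_mul, Real.norm_of_nonneg (Real.sqrt_nonneg _)]
    refine Real.le_sqrt_of_sq_le ?_
    rw [← sum_norm_sq_sub_of_projections (noiseProj_isHermitian _ _) (projPerp_isHermitian A)
      (noiseProj_mul_self ht K) (projPerp_mul_self hA)
      ((trace_noiseProj ht hK).trans (trace_projPerp hA).symm)]
    exact (Finset.single_le_sum (f := fun j => ‖(noiseProj (U t) K - projPerp A) i j‖ ^ 2)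
      (fun _ _ => sq_nonneg _) (Finset.mem_univ j)).trans
      (Finset.single_le_sum
        (f := fun i => ∑ j, ‖(noiseProj (U t) K - projPerp A) i j‖ ^ 2)
        (fun _ _ => Finset.sum_nonneg fun _ _ => sq_nonneg _) (Finset.mem_univ i))
  · have h1 : EntryBigO l (fun t => noiseProj (U t) K * (pinv A)ᴴ) e := by
      refine (hQA.mul_const (Aᴴ * A)⁻¹).congr (Eventually.of_forall fun t => ?_)
      rw [conjTranspose_pinv, Matrix.mul_assoc]
    refine (hN.mul h1).congr ?_
    filter_upwards [hid, hNQ] with t h2 h3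
    rw [h2, ← Matrix.mul_assoc, h3]

end Perturbation

section SourcePowers

variable {m K : ℕ} {A : Matrix (Fin m) (Fin K) ℂ} {p : Fin K → ℝ}
  {ι : Type*} {l : Filter ι} {e : ι → ℝ} {U : ι → Matrix (Fin m) (Fin m) ℂ}

lemma re_quadForm_diagonal (p : Fin K → ℝ) (w : Fin K → ℂ) :
    (star w ⬝ᵥ (diagonal (fun k => (p k : ℂ)) *ᵥ w)).re = ∑ k, p k * ‖w k‖ ^ 2 := by
  rw [dotProduct, Complex.re_sum]
  refine Finset.sum_congr rfl fun k _ => ?_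
  rw [mulVec_diagonal, ← Complex.normSq_eq_norm_sq, Complex.normSq_apply]
  simp
  ring

lemma diagonal_mul_diagonal_inv (hp : ∀ k, 0 < p k) :
    diagonal (fun k => (p k : ℂ)) * diagonal (fun k => (p k : ℂ)⁻¹) = 1 := by
  rw [diagonal_mul_diagonal, ← diagonal_one]
  congr 1
  ext k
  exact mul_inv_cancel₀ (Complex.ofReal_ne_zero.2 (hp k).ne')

/-- The error of the noise projector of `A P Aᴴ + σ² I + E`, the situation of direct
augmentation. -/
theorem noiseProj_perturbation_of_add (hK : K ≤ m) (hA : IsUnit (Aᴴ * A)) (hp : ∀ k, 0 < p k)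
    {s : ℝ} {E : ι → Matrix (Fin m) (Fin m) ℂ} (hE : EntryBigO l E e) {Λ : ι → Fin m → ℝ}
    (hdec : ∀ᶠ t in l, IsEigendecomp (A * diagonal (fun k => (p k : ℂ)) * Aᴴ +
      (s : ℂ) • (1 : Matrix (Fin m) (Fin m) ℂ) + E t) (U t) (Λ t)) :
    EntryBigO l (fun t => noiseProj (U t) K - projPerp A) e ∧
    EntryBigO l (fun t => noiseProj (U t) K * A * diagonal (fun k => (p k : ℂ)) +
      projPerp A * E t * (pinv A)ᴴ) (fun t => e t * e t) := by
  obtain ⟨-, h1, h2⟩ := noiseProj_perturbation hK hA (diagonal_mul_diagonal_inv hp)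
    (fun w => by
      rw [re_quadForm_diagonal]
      exact Finset.sum_nonneg fun k _ => mul_nonneg (hp k).le (sq_nonneg _)) hE hdec
  refine ⟨h1, (h2.sub ((h1.mul hE).mul_const (pinv A)ᴴ)).congr (Eventually.of_forall fun t => ?_)⟩
  rw [Matrix.sub_mul, Matrix.sub_mul]
  abel

/-- The error of the noise projector of `(A P Aᴴ + σ² I + E)²`, the situation of spatial
smoothing: to first order it is the same as without the square. The square is
`A G Aᴴ + σ⁴ I + E'` with `G = P W`, `W = Aᴴ A P + 2 σ²`, and `Q̂ E' A†ᴴ = Q̂ E A†ᴴ W` up to second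
order, so that the invertible factor `W` cancels. -/
theorem noiseProj_perturbation_of_sq (hK : K ≤ m) (hA : IsUnit (Aᴴ * A)) (hp : ∀ k, 0 < p k)
    {s : ℝ} (hs : 0 ≤ s) {E : ι → Matrix (Fin m) (Fin m) ℂ} (hE : EntryBigO l E e)
    (he : e =O[l] fun _ => (1 : ℝ)) {Λ : ι → Fin m → ℝ}
    (hdec : ∀ᶠ t in l, IsEigendecomp ((A * diagonal (fun k => (p k : ℂ)) * Aᴴ +
      (s : ℂ) • (1 : Matrix (Fin m) (Fin m) ℂ) + E t) * (A * diagonal (fun k => (p k : ℂ)) * Aᴴ +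
      (s : ℂ) • (1 : Matrix (Fin m) (Fin m) ℂ) + E t)) (U t) (Λ t)) :
    EntryBigO l (fun t => noiseProj (U t) K - projPerp A) e ∧
    EntryBigO l (fun t => noiseProj (U t) K * A * diagonal (fun k => (p k : ℂ)) +
      projPerp A * E t * (pinv A)ᴴ) (fun t => e t * e t) := by
  have hU : ∀ᶠ t in l, U t ∈ unitaryGroup (Fin m) ℂ := hdec.mono fun t ht => ht.unitary
  have hQ1 : EntryBigO l (fun t => noiseProj (U t) K) (fun _ => 1) := entryBigO_noiseProj hU
  set P : Matrix (Fin K) (Fin K) ℂ := diagonal (fun k => (p k : ℂ)) with hPdef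
  have hPP := diagonal_mul_diagonal_inv hp
  set P' : Matrix (Fin K) (Fin K) ℂ := diagonal (fun k => (p k : ℂ)⁻¹)
  have hPP' : P' * P = 1 := mul_eq_one_comm.1 hPP
  set W : Matrix (Fin K) (Fin K) ℂ := Aᴴ * A * P + ((2 * s : ℝ) : ℂ) • 1 with hW
  have hP : Pᴴ = P := by
    rw [hPdef, diagonal_conjTranspose]
    congr 1
    ext k
    simp
  have hquad : ∀ w, (star w ⬝ᵥ ((P * W) *ᵥ w)).re =
      ∑ i, ‖((A * P) *ᵥ w) i‖ ^ 2 + 2 * s * ∑ k, p k * ‖w k‖ ^ 2 := by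
    intro w
    have h1 : P * W = (A * P)ᴴ * (A * P) + ((2 * s : ℝ) : ℂ) • P := by
      rw [hW, Matrix.mul_add, Matrix.mul_smul, Matrix.mul_one, conjTranspose_mul, hP]
      simp only [Matrix.mul_assoc]
    rw [h1, add_mulVec, dotProduct_add, smul_mulVec, dotProduct_smul, ← mulVec_mulVec,
      ← star_mulVec_dotProduct, Complex.add_re, re_star_dotProduct_self, smul_eq_mul,
      Complex.re_ofReal_mul, re_quadForm_diagonal]
  have hpos : ∀ w : Fin K → ℂ, 0 ≤ 2 * s * ∑ k, p k * ‖w k‖ ^ 2 := fun w =>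
    mul_nonneg (by positivity)
      (Finset.sum_nonneg fun k _ => mul_nonneg (hp k).le (sq_nonneg _))
  have hunit : IsUnit (P * W) := by
    rw [← mulVec_injective_iff_isUnit]
    refine (injective_iff_map_eq_zero (P * W).mulVecLin).2 fun w hw => ?_
    rw [mulVecLin_apply] at hw
    have h1 := hquad w
    rw [hw, dotProduct_zero, Complex.zero_re] at h1
    have h2 : (A * P) *ᵥ w = 0 := by
      ext i
      have h3 : ∑ i, ‖((A * P) *ᵥ w) i‖ ^ 2 = 0 := by
        have := Finset.sum_nonneg (s := Finset.univ) (f := fun i => ‖((A * P) *ᵥ w) i‖ ^ 2)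
          fun _ _ => sq_nonneg _
        linarith [hpos w]
      have := (Finset.sum_eq_zero_iff_of_nonneg (fun _ _ => sq_nonneg _)).1 h3 i
        (Finset.mem_univ i)
      simpa using this
    calc w = (P' * (pinv A * (A * P))) *ᵥ w := by
          rw [← Matrix.mul_assoc (pinv A), pinv_mul_self hA, Matrix.one_mul, hPP', one_mulVec]
      _ = 0 := by rw [← mulVec_mulVec, ← mulVec_mulVec, h2]; simp
  have hG' : P * W * (P * W)⁻¹ = 1 := mul_nonsing_inv _ ((isUnit_iff_isUnit_det _).1 hunit)
  have hW' : W * ((P * W)⁻¹ * P) = 1 := by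
    calc _ = (P' * P) * W * ((P * W)⁻¹ * P) := by rw [hPP', Matrix.one_mul]
      _ = P' * (P * W * (P * W)⁻¹) * P := by simp only [Matrix.mul_assoc]
      _ = 1 := by rw [hG', Matrix.mul_one, hPP']
  set B := A * P * Aᴴ with hB
  set S₀ := B + (s : ℂ) • (1 : Matrix (Fin m) (Fin m) ℂ) with hS₀
  have hBX : B * (pinv A)ᴴ = A * P := by
    rw [hB, Matrix.mul_assoc, conjTranspose_mul_conjTranspose_pinv hA, Matrix.mul_one]
  have hXW : (S₀ + (s : ℂ) • 1) * (pinv A)ᴴ = (pinv A)ᴴ * W := by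
    rw [hS₀, hW, Matrix.mul_add, ← Matrix.mul_assoc, conjTranspose_pinv_mul hA, Matrix.add_mul,
      Matrix.add_mul, hBX, Matrix.smul_mul, Matrix.one_mul, Matrix.mul_smul, Matrix.mul_one,
      add_assoc, ← add_smul]
    congr 2
    push_cast
    ring
  have hE2 : EntryBigO l (fun t => E t * E t) (fun t => e t * e t) := hE.mul hE
  have he2 : (fun t => e t * e t) =O[l] e := by simpa using (isBigO_refl e l).mul he
  have hE' : EntryBigO l (fun t => S₀ * E t + E t * S₀ + E t * E t) e :=
    ((hE.const_mul S₀).add (hE.mul_const S₀)).add (hE2.trans he2)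
  have hdec' : ∀ᶠ t in l, IsEigendecomp (A * (P * W) * Aᴴ + ((s ^ 2 : ℝ) : ℂ) •
      (1 : Matrix (Fin m) (Fin m) ℂ) + (S₀ * E t + E t * S₀ + E t * E t)) (U t) (Λ t) := by
    filter_upwards [hdec] with t ht
    convert ht using 1
    have h1 : A * (P * W) * Aᴴ = B * B + ((2 * s : ℝ) : ℂ) • B := by
      rw [hW, hB, Matrix.mul_add, Matrix.mul_smul, Matrix.mul_one, Matrix.mul_add, Matrix.add_mul,
        Matrix.mul_smul, Matrix.smul_mul]
      simp only [Matrix.mul_assoc]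
    have h2 : S₀ * S₀ = B * B + ((2 * s : ℝ) : ℂ) • B + ((s ^ 2 : ℝ) : ℂ) • 1 := by
      rw [hS₀, Matrix.add_mul, Matrix.mul_add, Matrix.mul_add]
      simp only [Matrix.smul_mul, Matrix.mul_smul, Matrix.one_mul, Matrix.mul_one]
      push_cast
      module
    rw [h1, ← h2]
    noncomm_ring
  obtain ⟨h1, h2, h3⟩ := noiseProj_perturbation hK hA hG' (fun w => by
    rw [hquad]
    exact add_nonneg (Finset.sum_nonneg fun _ _ => sq_nonneg _) (hpos w)) hE' hdec'
  refine ⟨h2, ?_⟩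
  -- the terms by which `Q̂ E' A†ᴴ` differs from `Q̂ E A†ᴴ W`
  have h4 : EntryBigO l (fun t => noiseProj (U t) K * A * (P * Aᴴ) * E t * (pinv A)ᴴ +
      noiseProj (U t) K * (E t * E t) * (pinv A)ᴴ) (fun t => e t * e t) := by
    refine ((h1.mul_const _).mul hE).mul_const _ |>.add ?_
    simpa using (hQ1.mul hE2).mul_const (pinv A)ᴴ
  have h5 := ((h3.sub h4).mul_const ((P * W)⁻¹ * P))
  refine (h5.sub ((h2.mul hE).mul_const (pinv A)ᴴ)).congr (Eventually.of_forall fun t => ?_)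
  generalize noiseProj (U t) K = Q
  have h6 : Q * (S₀ * E t + E t * S₀ + E t * E t) * (pinv A)ᴴ =
      Q * A * (P * Aᴴ) * E t * (pinv A)ᴴ + Q * (E t * E t) * (pinv A)ᴴ +
        Q * E t * ((S₀ + (s : ℂ) • 1) * (pinv A)ᴴ) := by
    rw [hS₀, hB]
    simp only [Matrix.mul_add, Matrix.add_mul, Matrix.smul_mul, Matrix.mul_smul, Matrix.one_mul,
      Matrix.mul_one, Matrix.mul_assoc]
    abel
  have h7 : Q * A * (P * W) + Q * (S₀ * E t + E t * S₀ + E t * E t) * (pinv A)ᴴ -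
      (Q * A * (P * Aᴴ) * E t * (pinv A)ᴴ + Q * (E t * E t) * (pinv A)ᴴ) =
      (Q * A * P + Q * E t * (pinv A)ᴴ) * W := by
    rw [h6, hXW, Matrix.add_mul]
    simp only [Matrix.mul_assoc]
    abel
  rw [h7, Matrix.mul_assoc _ W, hW', Matrix.mul_one, Matrix.sub_mul, Matrix.sub_mul]
  abel

end SourcePowers

/-! ### Steering vectors of the virtual uniform linear array -/

section Steering

variable {Mv K : ℕ} {d₀ lam : ℝ}

/-- The node `e^{jφ(θ)}`, whose powers are the entries of the steering vector. -/
noncomputable def node (d₀ lam θ : ℝ) : ℂ := Complex.exp (Complex.I * (phase d₀ lam θ : ℂ))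

lemma node_ne_zero (d₀ lam θ : ℝ) : node d₀ lam θ ≠ 0 := Complex.exp_ne_zero _

lemma steeringVec_ula (d₀ lam θ : ℝ) (i : Fin Mv) :
    steeringVec (ula Mv) d₀ lam θ i = node d₀ lam θ ^ (i : ℕ) := by
  rw [node, ← Complex.exp_nat_mul, steeringVec, ula]
  congr 1
  push_cast
  ring

lemma hasDerivAt_phase (d₀ lam θ : ℝ) :
    HasDerivAt (phase d₀ lam) (2 * Real.pi * d₀ * Real.cos θ / lam) θ :=
  ((Real.hasDerivAt_sin θ).const_mul (2 * Real.pi * d₀)).div_const lam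

lemma hasDerivAt_node (d₀ lam θ : ℝ) : HasDerivAt (node d₀ lam)
    (node d₀ lam θ * (Complex.I * ((2 * Real.pi * d₀ * Real.cos θ / lam : ℝ) : ℂ))) θ :=
  ((hasDerivAt_phase d₀ lam θ).ofReal_comp.const_mul Complex.I).cexp

lemma contDiff_steeringVec (Mv : ℕ) (d₀ lam : ℝ) :
    ContDiff ℝ 2 (fun t : ℝ => steeringVec (ula Mv) d₀ lam t) := by
  refine contDiff_pi.2 fun i => ?_
  simp only [steeringVec, phase]
  have h : ContDiff ℝ 2 fun t : ℝ => ((2 * Real.pi * d₀ * Real.sin t / lam : ℝ) : ℂ) :=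
    Complex.ofRealCLM.contDiff.comp
      ((contDiff_const.mul Real.contDiff_sin).div_const lam)
  exact (contDiff_const.mul h).cexp

lemma hasDerivAt_steeringVec (Mv : ℕ) (d₀ lam θ : ℝ) :
    HasDerivAt (fun t : ℝ => steeringVec (ula Mv) d₀ lam t) (steeringDeriv Mv d₀ lam θ) θ :=
  ((contDiff_steeringVec Mv d₀ lam).differentiable (by norm_num) θ).hasDerivAt

lemma contDiff_steeringDeriv (Mv : ℕ) (d₀ lam : ℝ) : ContDiff ℝ 1 (steeringDeriv Mv d₀ lam) :=
  ((contDiff_succ_iff_deriv (n := 1)).1 (contDiff_steeringVec Mv d₀ lam)).2.2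

/-- The pairing of the steering vector with the coefficients of a polynomial is its value at the
node. -/
lemma sum_coeff_mul_steeringVec {q : Polynomial ℂ} (hq : q.natDegree < Mv) (d₀ lam θ : ℝ) :
    ∑ i : Fin Mv, q.coeff i * steeringVec (ula Mv) d₀ lam θ i = q.eval (node d₀ lam θ) := by
  rw [Polynomial.eval_eq_sum_range' hq, Finset.sum_range]
  simp only [steeringVec_ula]

lemma sum_coeff_mul_steeringDeriv {q : Polynomial ℂ} (hq : q.natDegree < Mv) (d₀ lam θ : ℝ) :
    ∑ i : Fin Mv, q.coeff i * steeringDeriv Mv d₀ lam θ i =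
      q.derivative.eval (node d₀ lam θ) *
        (node d₀ lam θ * (Complex.I * ((2 * Real.pi * d₀ * Real.cos θ / lam : ℝ) : ℂ))) := by
  have h1 : HasDerivAt (fun t => ∑ i : Fin Mv, q.coeff i * steeringVec (ula Mv) d₀ lam t i)
      (∑ i : Fin Mv, q.coeff i * steeringDeriv Mv d₀ lam θ i) θ :=
    HasDerivAt.fun_sum fun i _ =>
      ((hasDerivAt_pi.1 (hasDerivAt_steeringVec Mv d₀ lam θ)) i).const_mul _
  have h2 : HasDerivAt (fun t => q.eval (node d₀ lam t)) _ θ :=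
    (q.hasDerivAt (node d₀ lam θ)).comp θ (hasDerivAt_node d₀ lam θ)
  simp only [sum_coeff_mul_steeringVec hq] at h1
  exact h1.unique h2

variable {θ : Fin K → ℝ}

lemma sum_coeff_mul_steeringMat_mulVec {q : Polynomial ℂ} (hq : q.natDegree < Mv)
    (w : Fin K → ℂ) :
    ∑ i : Fin Mv, q.coeff i * (steeringMat (ula Mv) d₀ lam θ *ᵥ w) i =
      ∑ k, q.eval (node d₀ lam (θ k)) * w k := by
  simp only [mulVec, dotProduct, Finset.mul_sum]
  rw [Finset.sum_comm]
  refine Finset.sum_congr rfl fun k _ => ?_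
  rw [← sum_coeff_mul_steeringVec hq, Finset.sum_mul]
  exact Finset.sum_congr rfl fun i _ => by rw [steeringMat, of_apply, mul_assoc]

/-- Half a wavelength is the largest spacing without spatial aliasing. The endpoints `±π/2` have
the same node if `d₀ = lam / 2`, so one of the directions must not be an endpoint. -/
lemma node_injOn (hd₀ : 0 < d₀) (hlam : d₀ ≤ lam / 2) {s t : ℝ}
    (hs : s ∈ Set.Icc (-(Real.pi / 2)) (Real.pi / 2))
    (ht : t ∈ Set.Ioo (-(Real.pi / 2)) (Real.pi / 2))
    (h : node d₀ lam s = node d₀ lam t) : s = t := by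
  have hl : 0 < lam := by linarith
  have hc : 0 < 2 * Real.pi * d₀ / lam := by have := Real.pi_pos; positivity
  have hc' : 2 * Real.pi * d₀ / lam ≤ Real.pi := by
    rw [div_le_iff₀ hl]
    nlinarith [Real.pi_pos]
  have hp : ∀ u, phase d₀ lam u = 2 * Real.pi * d₀ / lam * Real.sin u := fun u => by
    rw [phase]; ring
  have ht1 : Real.sin t < 1 := by
    rw [← Real.sin_pi_div_two]
    exact Real.strictMonoOn_sin ⟨ht.1.le, ht.2.le⟩ ⟨by linarith [Real.pi_pos], le_rfl⟩ ht.2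
  have ht2 : -1 < Real.sin t := by
    rw [← Real.sin_pi_div_two, ← Real.sin_neg]
    exact Real.strictMonoOn_sin ⟨le_rfl, by linarith [Real.pi_pos]⟩ ⟨ht.1.le, ht.2.le⟩ ht.1
  obtain ⟨n, hn⟩ := Complex.exp_eq_exp_iff_exists_int.1 h
  have hn' : phase d₀ lam s = phase d₀ lam t + n * (2 * Real.pi) := by
    have : Complex.I * (phase d₀ lam s : ℂ) =
        Complex.I * ((phase d₀ lam t + n * (2 * Real.pi) : ℝ) : ℂ) := by
      rw [hn]
      push_cast
      ring
    exact_mod_cast mul_left_cancel₀ Complex.I_ne_zero this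
  have hs1 := Real.sin_le_one s
  have hs2 := Real.neg_one_le_sin s
  have hlt : |phase d₀ lam s - phase d₀ lam t| < 2 * Real.pi := by
    rw [hp, hp, abs_lt]
    constructor <;> nlinarith
  have hn0 : n = 0 := by
    rw [hn', add_sub_cancel_left, abs_mul, abs_of_pos (by positivity : 0 < 2 * Real.pi)] at hlt
    have : |(n : ℝ)| < 1 := by
      by_contra hcon
      push Not at hcon
      nlinarith [Real.pi_pos]
    exact Int.abs_lt_one_iff.1 (by exact_mod_cast this)
  rw [hn0, hp, hp] at hn'
  refine Real.injOn_sin hs ⟨ht.1.le, ht.2.le⟩ ?_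
  have : 2 * Real.pi * d₀ / lam * Real.sin s = 2 * Real.pi * d₀ / lam * Real.sin t := by
    simpa using hn'
  exact mul_left_cancel₀ hc.ne' this

/-- The polynomial whose roots are the nodes of the directions in `s`. -/
noncomputable def nodePoly (d₀ lam : ℝ) (θ : Fin K → ℝ) (s : Finset (Fin K)) : Polynomial ℂ :=
  ∏ k ∈ s, (Polynomial.X - Polynomial.C (node d₀ lam (θ k)))

lemma natDegree_nodePoly (d₀ lam : ℝ) (θ : Fin K → ℝ) (s : Finset (Fin K)) :
    (nodePoly d₀ lam θ s).natDegree ≤ K := by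
  rw [nodePoly, Polynomial.natDegree_prod_of_monic _ _ fun _ _ => Polynomial.monic_X_sub_C _]
  simpa using s.card_le_univ

lemma eval_nodePoly_eq_zero_iff {s : Finset (Fin K)} {z : ℂ} :
    (nodePoly d₀ lam θ s).eval z = 0 ↔ ∃ k ∈ s, z = node d₀ lam (θ k) := by
  simp [nodePoly, Polynomial.eval_prod, Finset.prod_eq_zero_iff, sub_eq_zero]

open scoped ComplexOrder in
lemma isUnit_gram_steeringMat (hKMv : K < Mv) (hd₀ : 0 < d₀) (hlam : d₀ ≤ lam / 2)
    (hθ : Function.Injective θ)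
    (hθ_range : ∀ k, θ k ∈ Set.Ioo (-(Real.pi / 2)) (Real.pi / 2)) :
    IsUnit ((steeringMat (ula Mv) d₀ lam θ)ᴴ * steeringMat (ula Mv) d₀ lam θ) := by
  rw [← mulVec_injective_iff_isUnit]
  refine (injective_iff_map_eq_zero
    ((steeringMat (ula Mv) d₀ lam θ)ᴴ * steeringMat (ula Mv) d₀ lam θ).mulVecLin).2 fun w hw => ?_
  rw [mulVecLin_apply] at hw
  have h0 : steeringMat (ula Mv) d₀ lam θ *ᵥ w = 0 := by
    rwa [conjTranspose_mul_self_mulVec_eq_zero] at hw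
  ext k
  have h1 := sum_coeff_mul_steeringMat_mulVec (d₀ := d₀) (lam := lam) (θ := θ)
    ((natDegree_nodePoly d₀ lam θ (Finset.univ.erase k)).trans_lt hKMv) w
  rw [h0, Finset.sum_eq_single k] at h1
  · have h2 : (nodePoly d₀ lam θ (Finset.univ.erase k)).eval (node d₀ lam (θ k)) ≠ 0 := by
      rw [Ne, eval_nodePoly_eq_zero_iff]
      rintro ⟨j, hj, h⟩
      have := hθ (node_injOn hd₀ hlam (Set.Ioo_subset_Icc_self (hθ_range k)) (hθ_range j) h)
      exact Finset.ne_of_mem_erase hj this.symm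
    simpa [h2] using h1
  · intro j _ hj
    rw [eval_nodePoly_eq_zero_iff.2 ⟨j, by simp [hj], rfl⟩, zero_mul]
  · simp

lemma re_quadForm_projPerp_pos {A : Matrix (Fin Mv) (Fin K) ℂ} (hA : IsUnit (Aᴴ * A))
    {v : Fin Mv → ℂ} (hv : ∀ w, v ≠ A *ᵥ w) : 0 < (star v ⬝ᵥ (projPerp A *ᵥ v)).re := by
  have h1 : star v ⬝ᵥ (projPerp A *ᵥ v) = star (projPerp A *ᵥ v) ⬝ᵥ (projPerp A *ᵥ v) := by
    rw [star_mulVec_dotProduct, (projPerp_isHermitian A).eq, mulVec_mulVec, projPerp_mul_self hA]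
  rw [h1, re_star_dotProduct_self]
  obtain ⟨i, hi⟩ : ∃ i, (projPerp A *ᵥ v) i ≠ 0 := by
    by_contra! hcon
    refine hv (pinv A *ᵥ v) ?_
    have : projPerp A *ᵥ v = 0 := funext hcon
    rwa [projPerp, sub_mulVec, one_mulVec, sub_eq_zero, ← mulVec_mulVec] at this
  exact Finset.sum_pos' (fun _ _ => sq_nonneg _)
    ⟨i, Finset.mem_univ _, by have := norm_pos_iff.2 hi; positivity⟩

lemma steeringVec_notMem_range (hKMv : K < Mv) (hd₀ : 0 < d₀) (hlam : d₀ ≤ lam / 2)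
    (hθ_range : ∀ k, θ k ∈ Set.Ioo (-(Real.pi / 2)) (Real.pi / 2)) {t : ℝ}
    (ht : t ∈ Set.Icc (-(Real.pi / 2)) (Real.pi / 2)) (htθ : t ∉ Set.range θ) (w : Fin K → ℂ) :
    steeringVec (ula Mv) d₀ lam t ≠ steeringMat (ula Mv) d₀ lam θ *ᵥ w := by
  intro h
  have hq := (natDegree_nodePoly d₀ lam θ Finset.univ).trans_lt hKMv
  have h1 := sum_coeff_mul_steeringVec hq d₀ lam t
  rw [h, sum_coeff_mul_steeringMat_mulVec hq, Finset.sum_eq_zero fun k _ => by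
    rw [eval_nodePoly_eq_zero_iff.2 ⟨k, Finset.mem_univ k, rfl⟩, zero_mul], eq_comm,
    eval_nodePoly_eq_zero_iff] at h1
  obtain ⟨k, -, hk⟩ := h1
  exact htθ ⟨k, (node_injOn hd₀ hlam ht (hθ_range k) hk).symm⟩

lemma steeringDeriv_notMem_range (hKMv : K < Mv) (hd₀ : 0 < d₀) (hlam : d₀ ≤ lam / 2)
    (hθ : Function.Injective θ)
    (hθ_range : ∀ k, θ k ∈ Set.Ioo (-(Real.pi / 2)) (Real.pi / 2)) (k : Fin K)
    (w : Fin K → ℂ) : steeringDeriv Mv d₀ lam (θ k) ≠ steeringMat (ula Mv) d₀ lam θ *ᵥ w := by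
  intro h
  have hq := (natDegree_nodePoly d₀ lam θ Finset.univ).trans_lt hKMv
  have h1 := sum_coeff_mul_steeringDeriv hq d₀ lam (θ k)
  rw [h, sum_coeff_mul_steeringMat_mulVec hq, Finset.sum_eq_zero fun k _ => by
    rw [eval_nodePoly_eq_zero_iff.2 ⟨k, Finset.mem_univ k, rfl⟩, zero_mul], eq_comm,
    mul_eq_zero] at h1
  have hl : 0 < lam := by linarith
  have hcos := Real.cos_pos_of_mem_Ioo (hθ_range k)
  have h2 : node d₀ lam (θ k) * (Complex.I *
      ((2 * Real.pi * d₀ * Real.cos (θ k) / lam : ℝ) : ℂ)) ≠ 0 := by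
    refine mul_ne_zero (node_ne_zero _ _ _) (mul_ne_zero Complex.I_ne_zero
      (Complex.ofReal_ne_zero.2 ?_))
    have := Real.pi_pos
    positivity
  have h3 : (nodePoly d₀ lam θ Finset.univ).derivative.eval (node d₀ lam (θ k)) =
      (nodePoly d₀ lam θ (Finset.univ.erase k)).eval (node d₀ lam (θ k)) := by
    rw [nodePoly, ← Finset.mul_prod_erase _ _ (Finset.mem_univ k), Polynomial.derivative_mul]
    simp [nodePoly]
  rw [h3, eval_nodePoly_eq_zero_iff] at h1
  obtain ⟨j, hj, h⟩ := h1.resolve_right h2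
  have := hθ (node_injOn hd₀ hlam (Set.Ioo_subset_Icc_self (hθ_range k)) (hθ_range j) h)
  exact Finset.ne_of_mem_erase hj this.symm

end Steering

/-! ### Localisation of the deepest local minima -/

section Localisation

variable {K : ℕ}

/-- `est` lists `K` distinct local minimizers of `f` in the interval `(a, b)`, and no other local
minimum in the interval is deeper. -/
def IsDeepestMinima (a b : ℝ) (f : ℝ → ℝ) (est : Fin K → ℝ) : Prop :=
  Function.Injective est ∧ (∀ k, est k ∈ Set.Ioo a b ∧ IsLocalMin f (est k)) ∧
    ∀ x ∈ Set.Ioo a b, IsLocalMin f x → x ∉ Set.range est → ∀ k, f (est k) ≤ f x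

/-- A permutation that preserves the order of distinct real numbers `θ k` is the identity. -/
lemma eq_id_of_strictMono_comp {κ : Type*} [Finite κ] {θ : κ → ℝ} (hθ : Function.Injective θ)
    {π : κ → κ} (hπ : ∀ i j, θ i < θ j → θ (π i) < θ (π j)) : π = id := by
  let _ : LinearOrder κ := LinearOrder.lift' θ hθ
  have hmono : StrictMono π := fun i j hij => hπ i j hij
  have hwf : WellFoundedLT κ := Finite.to_wellFoundedLT
  have h : hmono.orderIsoOfSurjective π (Finite.surjective_of_injective hmono.injective) =
      OrderIso.refl κ := Subsingleton.elim _ _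
  funext i
  exact congrArg (fun g : κ ≃o κ => g i) h

variable {a b r c : ℝ} {θ : Fin K → ℝ} {f f₁ f₂ : ℝ → ℝ}

/-- If `f` is strictly convex on disjoint intervals of radius `r` around the `θ k`, below `c` at
the `θ k` and above `c` outside of these intervals, then the deepest minima are one in each
interval. -/
lemma deepestMinima_of_wells (hθ : Function.Injective θ)
    (hsep : ∀ i j, θ i < θ j → θ i + r < θ j - r) (hr : 0 < r)
    (hsub : ∀ k, Set.Icc (θ k - r) (θ k + r) ⊆ Set.Ioo a b)
    (h₁ : ∀ x, HasDerivAt f (f₁ x) x) (h₂ : ∀ x, HasDerivAt f₁ (f₂ x) x)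
    (hconv : ∀ k, ∀ x ∈ Set.Icc (θ k - r) (θ k + r), 0 < f₂ x)
    (hlow : ∀ k, f (θ k) < c)
    (hhigh : ∀ x ∈ Set.Icc a b, (∀ k, r ≤ |x - θ k|) → c < f x) :
    (∃ est, IsDeepestMinima a b f est ∧ SameOrder θ est) ∧
    ∀ est, IsDeepestMinima a b f est → SameOrder θ est → ∀ k, |est k - θ k| < r := by
  have hcont : Continuous f := continuous_iff_continuousAt.2 fun x => (h₁ x).continuousAt
  have hfar : ∀ k j, j ≠ k → 2 * r < |θ k - θ j| := by
    intro k j hjk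
    rcases lt_or_gt_of_ne (hθ.ne hjk) with h | h
    · rw [abs_of_pos (by linarith)]
      linarith [hsep _ _ h]
    · rw [abs_of_neg (by linarith)]
      linarith [hsep _ _ h]
  have hbd : ∀ k, ∀ x, |x - θ k| = r → c < f x := by
    intro k x hx
    refine hhigh x (Set.Ioo_subset_Icc_self (hsub k ?_)) fun j => ?_
    · obtain ⟨h1, h2⟩ := abs_le.1 hx.le
      exact ⟨by linarith, by linarith⟩
    · by_cases hjk : j = k
      · rw [hjk, hx]
      · have h1 := hfar k j hjk
        have h2 := abs_sub_le (θ k) x (θ j)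
        rw [abs_sub_comm (θ k) x, hx] at h2
        linarith
  have hmin : ∀ k, ∃ x, |x - θ k| < r ∧ IsLocalMin f x ∧ f x < c := by
    intro k
    obtain ⟨x, hx, hxmin⟩ := (isCompact_Icc (a := θ k - r) (b := θ k + r)).exists_isMinOn
      ⟨θ k, by constructor <;> linarith⟩ hcont.continuousOn
    have hxc : f x < c := (hxmin (by constructor <;> linarith : θ k ∈ _)).trans_lt (hlow k)
    have hxr : |x - θ k| < r := by
      refine lt_of_le_of_ne (abs_le.2 ⟨by linarith [hx.1], by linarith [hx.2]⟩) fun h => ?_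
      exact (hbd k x h).not_gt hxc
    obtain ⟨h1, h2⟩ := abs_lt.1 hxr
    exact ⟨x, hxr, hxmin.isLocalMin (Icc_mem_nhds (by linarith) (by linarith)), hxc⟩
  choose m hmr hmmin hmc using hmin
  have huniq : ∀ k x, |x - θ k| < r → IsLocalMin f x → x = m k := by
    intro k x hx hxmin
    have hmono : StrictMonoOn f₁ (Set.Icc (θ k - r) (θ k + r)) := by
      refine strictMonoOn_of_deriv_pos (convex_Icc _ _)
        (fun x _ => (h₂ x).continuousAt.continuousWithinAt) fun x hx => ?_
      rw [(h₂ x).deriv]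
      exact hconv k x (interior_subset hx)
    have hmem : ∀ y, |y - θ k| < r → y ∈ Set.Icc (θ k - r) (θ k + r) := fun y hy => by
      obtain ⟨h1, h2⟩ := abs_lt.1 hy
      exact ⟨by linarith, by linarith⟩
    exact hmono.injOn (hmem x hx) (hmem _ (hmr k))
      ((hxmin.hasDerivAt_eq_zero (h₁ x)).trans ((hmmin k).hasDerivAt_eq_zero (h₁ _)).symm)
  have hord : ∀ i j, θ i < θ j → m i < m j := by
    intro i j hij
    have h1 := abs_lt.1 (hmr i)
    have h2 := abs_lt.1 (hmr j)
    linarith [hsep i j hij, h1.2, h2.1]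
  have hminj : Function.Injective m := by
    intro i j hij
    by_contra hne
    rcases lt_or_gt_of_ne (hθ.ne hne) with h | h
    · exact (hord _ _ h).ne hij
    · exact (hord _ _ h).ne' hij
  have hmI : ∀ k, m k ∈ Set.Ioo a b := fun k => hsub k (by
    obtain ⟨h1, h2⟩ := abs_lt.1 (hmr k)
    exact ⟨by linarith, by linarith⟩)
  refine ⟨⟨m, ⟨hminj, fun k => ⟨hmI k, hmmin k⟩, ?_⟩, hord⟩, ?_⟩
  · intro x hx hxmin hxr k
    refine (hmc k).le.trans (hhigh x (Set.Ioo_subset_Icc_self hx) fun j => ?_).le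
    by_contra! hcon
    exact hxr ⟨j, (huniq j x hcon hxmin).symm⟩
  · rintro est ⟨hinj, hloc, hdeep⟩ hso
    have hrange : ∀ k, ∃ j, m j = est k := by
      intro k
      by_contra! hk
      have h1 : c < f (est k) := by
        refine hhigh _ (Set.Ioo_subset_Icc_self (hloc k).1) fun j => ?_
        by_contra! hcon
        exact hk j (huniq j _ hcon (hloc k).2).symm
      -- the `K` points `m j` cannot all be among the `K - 1` points `est i` with `i ≠ k`
      obtain ⟨j, hj⟩ : ∃ j, m j ∉ Set.range est := by
        by_contra! hall
        choose g hg using hall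
        have hginj : Function.Injective g := fun i j hij => hminj (by rw [← hg i, ← hg j, hij])
        obtain ⟨j, hj⟩ := Finite.surjective_of_injective hginj k
        exact hk j (by rw [← hg j, hj])
      exact ((h1.trans_le (hdeep (m j) (hmI j) (hmmin j) hj k)).trans (hmc j)).false
    choose π hπ using hrange
    have hπid : π = id := by
      refine eq_id_of_strictMono_comp hθ fun i j hij => ?_
      by_contra! hcon
      have h1 := hso i j hij
      rw [← hπ i, ← hπ j] at h1
      rcases hcon.lt_or_eq with h | h
      · exact (h1.trans (hord _ _ h)).false
      · rw [hθ h] at h1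
        exact h1.false
    intro k
    rw [← hπ k, hπid]
    exact hmr k

variable {T : Type*} [TopologicalSpace T] {F F₁ F₂ : T → ℝ → ℝ} {Q₀ : T}

/-- For a family of functions that depends continuously on a parameter, the deepest minima exist
near a parameter `Q₀` at which the `θ k` are the only zeros and nondegenerate, and they converge to
the `θ k`. -/
theorem eventually_deepestMinima (hθ : Function.Injective θ) (hθ_range : ∀ k, θ k ∈ Set.Ioo a b)
    (hF : Continuous (Function.uncurry F)) (hF₂ : Continuous (Function.uncurry F₂))
    (h₁ : ∀ Q x, HasDerivAt (F Q) (F₁ Q x) x) (h₂ : ∀ Q x, HasDerivAt (F₁ Q) (F₂ Q x) x)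
    (hzero : ∀ k, F Q₀ (θ k) = 0) (hpos : ∀ x ∈ Set.Icc a b, x ∉ Set.range θ → 0 < F Q₀ x)
    (hcurv : ∀ k, 0 < F₂ Q₀ (θ k)) {δ : ℝ} (hδ : 0 < δ) :
    ∀ᶠ Q in 𝓝 Q₀, (∃ est, IsDeepestMinima a b (F Q) est ∧ SameOrder θ est) ∧
      ∀ est, IsDeepestMinima a b (F Q) est → SameOrder θ est → ∀ k, |est k - θ k| < δ := by
  have hnear : ∀ (x : ℝ) (s : Set ℝ), s ∈ 𝓝 x → ∀ᶠ r in 𝓝[>] (0 : ℝ),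
      Set.Icc (x - r) (x + r) ⊆ s := by
    intro x s hs
    obtain ⟨ε, hε, h⟩ := Metric.mem_nhds_iff.1 hs
    filter_upwards [Ioo_mem_nhdsGT hε] with r hr y hy
    refine h ?_
    rw [Metric.mem_ball, Real.dist_eq, abs_lt]
    constructor <;> linarith [hy.1, hy.2, hr.1, hr.2]
  obtain ⟨r, hr, hrδ, hsub, hconv, hsep⟩ : ∃ r : ℝ, 0 < r ∧ r < δ ∧
      (∀ k, Set.Icc (θ k - r) (θ k + r) ⊆ Set.Ioo a b) ∧
      (∀ k, Set.Icc (θ k - r) (θ k + r) ⊆ {x | 0 < F₂ Q₀ x}) ∧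
      ∀ i j, θ i < θ j → θ i + r < θ j - r := by
    have hsep : ∀ᶠ r in 𝓝[>] (0 : ℝ), ∀ i j, θ i < θ j → θ i + r < θ j - r := by
      refine eventually_all.2 fun i => eventually_all.2 fun j => ?_
      by_cases hij : θ i < θ j
      · filter_upwards [Ioo_mem_nhdsGT (show 0 < (θ j - θ i) / 2 by linarith)] with r hr _
        linarith [hr.2]
      · exact Eventually.of_forall fun r h => absurd h hij
    have hcF : Continuous (F₂ Q₀) := hF₂.comp (Continuous.prodMk_right Q₀)
    have hsmall : ∀ᶠ r in 𝓝[>] (0 : ℝ), r ∈ Set.Ioo 0 δ := Ioo_mem_nhdsGT hδ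
    obtain ⟨r, hr⟩ := ((hsmall.and
      (eventually_all.2 fun k => hnear (θ k) _ (Ioo_mem_nhds (hθ_range k).1 (hθ_range k).2))).and
      ((eventually_all.2 fun k => hnear (θ k) {x | 0 < F₂ Q₀ x}
        ((isOpen_lt continuous_const hcF).mem_nhds (hcurv k))).and hsep)).exists
    exact ⟨r, hr.1.1.1, hr.1.1.2, hr.1.2, hr.2.1, hr.2.2⟩
  have hcpt : IsCompact (Set.Icc a b ∩ {x | ∀ k, r ≤ |x - θ k|}) := by
    refine isCompact_Icc.inter_right ?_
    simp only [Set.ofPred_forall]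
    exact isClosed_iInter fun k => isClosed_le continuous_const (by fun_prop)
  have hcF : Continuous (F Q₀) := hF.comp (Continuous.prodMk_right Q₀)
  obtain ⟨c, hc, hcle⟩ := hcpt.exists_forall_le' (a := (0 : ℝ)) hcF.continuousOn fun x hx => by
    refine hpos x hx.1 ?_
    rintro ⟨k, rfl⟩
    have := hx.2 k
    simp only [sub_self, abs_zero] at this
    linarith
  have e1 : ∀ᶠ Q in 𝓝 Q₀, ∀ x ∈ Set.Icc a b ∩ {x | ∀ k, r ≤ |x - θ k|}, c / 2 < F Q x :=
    hcpt.eventually_forall_of_forall_eventually fun x hx =>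
      (isOpen_lt continuous_const hF).mem_nhds
        (show c / 2 < F Q₀ x by linarith [hcle x hx])
  have e2 : ∀ᶠ Q in 𝓝 Q₀, ∀ k, F Q (θ k) < c / 2 := by
    refine eventually_all.2 fun k => ?_
    exact (isOpen_lt (hF.comp (Continuous.prodMk_left (θ k))) continuous_const).mem_nhds
      (show F Q₀ (θ k) < c / 2 by rw [hzero k]; linarith)
  have e3 : ∀ᶠ Q in 𝓝 Q₀, ∀ k, ∀ x ∈ Set.Icc (θ k - r) (θ k + r), 0 < F₂ Q x := by
    refine eventually_all.2 fun k => ?_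
    exact isCompact_Icc.eventually_forall_of_forall_eventually fun x hx =>
      (isOpen_lt continuous_const hF₂).mem_nhds (hconv k hx)
  filter_upwards [e1, e2, e3] with Q q1 q2 q3
  obtain ⟨h3, h4⟩ := deepestMinima_of_wells hθ hsep hr hsub (h₁ Q) (h₂ Q) q3 q2
    fun x hx hk => q1 x ⟨hx, hk⟩
  exact ⟨h3, fun est he hs k => (h4 est he hs k).trans hrδ⟩

/-- First-order expansion of a critical point `x t` near `x₀`, by the mean value theorem: Newton's
step from `x₀`. -/
theorem isLittleO_critical_point_sub {ι : Type*} {l : Filter ι} {Q : ι → T} {x : ι → ℝ} {x₀ : ℝ}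
    {e : ι → ℝ} (hF₂ : Continuous (Function.uncurry F₂))
    (h₂ : ∀ Q x, HasDerivAt (F₁ Q) (F₂ Q x) x) (hcurv : F₂ Q₀ x₀ ≠ 0)
    (hQ : Tendsto Q l (𝓝 Q₀)) (hx : Tendsto x l (𝓝 x₀)) (hcrit : ∀ᶠ t in l, F₁ (Q t) (x t) = 0)
    (he : (fun t => F₁ (Q t) x₀) =O[l] e) :
    (fun t => x t - x₀ + F₁ (Q t) x₀ / F₂ Q₀ x₀) =o[l] e := by
  have hmvt : ∀ t, ∃ y ∈ Set.uIcc x₀ (x t), F₁ (Q t) (x t) - F₁ (Q t) x₀ =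
      F₂ (Q t) y * (x t - x₀) := by
    intro t
    rcases lt_trichotomy x₀ (x t) with h | h | h
    · obtain ⟨y, hy, hy'⟩ := exists_hasDerivAt_eq_slope (F₁ (Q t)) (F₂ (Q t)) h
        (fun z _ => (h₂ (Q t) z).continuousAt.continuousWithinAt) fun z _ => h₂ (Q t) z
      refine ⟨y, Set.Icc_subset_uIcc (Set.Ioo_subset_Icc_self hy), ?_⟩
      rw [hy', div_mul_cancel₀ _ (by linarith)]
    · exact ⟨x₀, Set.left_mem_uIcc, by rw [← h]; ring⟩
    · obtain ⟨y, hy, hy'⟩ := exists_hasDerivAt_eq_slope (F₁ (Q t)) (F₂ (Q t)) h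
        (fun z _ => (h₂ (Q t) z).continuousAt.continuousWithinAt) fun z _ => h₂ (Q t) z
      refine ⟨y, Set.Icc_subset_uIcc' (Set.Ioo_subset_Icc_self hy), ?_⟩
      rw [hy']
      field_simp [(by linarith : x₀ - x t ≠ 0)]
      ring
  choose y hy hy' using hmvt
  have hyx : Tendsto y l (𝓝 x₀) := by
    rw [tendsto_iff_norm_sub_tendsto_zero] at hx ⊢
    refine squeeze_zero (fun _ => norm_nonneg _) (fun t => ?_) hx
    rw [Real.norm_eq_abs, Real.norm_eq_abs]
    exact Set.abs_sub_left_of_mem_uIcc (hy t)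
  have hcF : Tendsto (fun t => F₂ (Q t) (y t)) l (𝓝 (F₂ Q₀ x₀)) :=
    (hF₂.tendsto (Q₀, x₀)).comp (hQ.prodMk_nhds hyx)
  have hlim : Tendsto (fun t => 1 / F₂ Q₀ x₀ - 1 / F₂ (Q t) (y t)) l (𝓝 0) := by
    simpa using (tendsto_const_nhds (x := 1 / F₂ Q₀ x₀)).sub (hcF.inv₀ hcurv)
  have h1 : (fun t => (1 / F₂ Q₀ x₀ - 1 / F₂ (Q t) (y t)) * F₁ (Q t) x₀) =o[l]
      fun t => 1 * e t :=
    ((isLittleO_one_iff ℝ).2 hlim).mul_isBigO he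
  simp only [one_mul] at h1
  refine h1.congr' ?_ EventuallyEq.rfl
  filter_upwards [hcrit, hcF.eventually_ne hcurv] with t h3 h4
  have h5 := hy' t
  rw [h3, zero_sub] at h5
  have h6 : x t - x₀ = -F₁ (Q t) x₀ / F₂ (Q t) (y t) := by
    rw [h5, mul_div_cancel_left₀ _ h4]
  rw [h6]
  ring

end Localisation

/-! ### The null spectrum as a function of the noise projector -/

section NullSpectrum

variable {Mv K : ℕ} {d₀ lam : ℝ}

/-- The null spectrum `a(θ)ᴴ Q a(θ)`. -/
noncomputable def spectrumFun (d₀ lam : ℝ) (Q : Matrix (Fin Mv) (Fin Mv) ℂ) (x : ℝ) : ℝ :=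
  (star (steeringVec (ula Mv) d₀ lam x) ⬝ᵥ (Q *ᵥ steeringVec (ula Mv) d₀ lam x)).re

/-- The derivative of the null spectrum with respect to the direction. -/
noncomputable def spectrumFunDeriv (d₀ lam : ℝ) (Q : Matrix (Fin Mv) (Fin Mv) ℂ) (x : ℝ) : ℝ :=
  (star (steeringDeriv Mv d₀ lam x) ⬝ᵥ (Q *ᵥ steeringVec (ula Mv) d₀ lam x) +
    star (steeringVec (ula Mv) d₀ lam x) ⬝ᵥ (Q *ᵥ steeringDeriv Mv d₀ lam x)).re

/-- The second derivative of the null spectrum with respect to the direction. -/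
noncomputable def spectrumFunDeriv2 (d₀ lam : ℝ) (Q : Matrix (Fin Mv) (Fin Mv) ℂ) (x : ℝ) : ℝ :=
  (star (deriv (steeringDeriv Mv d₀ lam) x) ⬝ᵥ (Q *ᵥ steeringVec (ula Mv) d₀ lam x) +
    star (steeringDeriv Mv d₀ lam x) ⬝ᵥ (Q *ᵥ steeringDeriv Mv d₀ lam x) +
    (star (steeringDeriv Mv d₀ lam x) ⬝ᵥ (Q *ᵥ steeringDeriv Mv d₀ lam x) +
    star (steeringVec (ula Mv) d₀ lam x) ⬝ᵥ (Q *ᵥ deriv (steeringDeriv Mv d₀ lam) x))).re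

lemma hasDerivAt_sesquilinear {n : ℕ} (Q : Matrix (Fin n) (Fin n) ℂ) {u v : ℝ → Fin n → ℂ}
    {u' v' : Fin n → ℂ} {x : ℝ} (hu : HasDerivAt u u' x) (hv : HasDerivAt v v' x) :
    HasDerivAt (fun t => star (u t) ⬝ᵥ (Q *ᵥ v t))
      (star u' ⬝ᵥ (Q *ᵥ v x) + star (u x) ⬝ᵥ (Q *ᵥ v')) x := by
  simp only [dotProduct, mulVec, ← Finset.sum_add_distrib, Pi.star_apply]
  refine HasDerivAt.fun_sum fun i _ => ?_
  refine HasDerivAt.mul ((hasDerivAt_pi.1 hu i).star) (HasDerivAt.fun_sum fun j _ => ?_)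
  exact (hasDerivAt_pi.1 hv j).const_mul _

lemma HasDerivAt.complex_re {f : ℝ → ℂ} {f' : ℂ} {x : ℝ} (h : HasDerivAt f f' x) :
    HasDerivAt (fun t => (f t).re) f'.re x :=
  Complex.reCLM.hasFDerivAt.comp_hasDerivAt x h

lemma hasDerivAt_steeringDeriv (Mv : ℕ) (d₀ lam x : ℝ) :
    HasDerivAt (steeringDeriv Mv d₀ lam) (deriv (steeringDeriv Mv d₀ lam) x) x :=
  ((contDiff_steeringDeriv Mv d₀ lam).differentiable (by norm_num) x).hasDerivAt

lemma hasDerivAt_spectrumFun (Q : Matrix (Fin Mv) (Fin Mv) ℂ) (x : ℝ) :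
    HasDerivAt (spectrumFun d₀ lam Q) (spectrumFunDeriv d₀ lam Q x) x :=
  (hasDerivAt_sesquilinear Q (hasDerivAt_steeringVec Mv d₀ lam x)
    (hasDerivAt_steeringVec Mv d₀ lam x)).complex_re

lemma hasDerivAt_spectrumFunDeriv (Q : Matrix (Fin Mv) (Fin Mv) ℂ) (x : ℝ) :
    HasDerivAt (spectrumFunDeriv d₀ lam Q) (spectrumFunDeriv2 d₀ lam Q x) x :=
  HasDerivAt.complex_re ((hasDerivAt_sesquilinear Q (hasDerivAt_steeringDeriv Mv d₀ lam x)
    (hasDerivAt_steeringVec Mv d₀ lam x)).add (hasDerivAt_sesquilinear Q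
    (hasDerivAt_steeringVec Mv d₀ lam x) (hasDerivAt_steeringDeriv Mv d₀ lam x)))

lemma continuous_sesquilinear {n : ℕ} {u v : ℝ → Fin n → ℂ} (hu : Continuous u)
    (hv : Continuous v) :
    Continuous fun z : Matrix (Fin n) (Fin n) ℂ × ℝ => star (u z.2) ⬝ᵥ (z.1 *ᵥ v z.2) :=
  Continuous.dotProduct (hu.comp continuous_snd).star
    (continuous_fst.matrix_mulVec (hv.comp continuous_snd))

lemma continuous_spectrumFun :
    Continuous (Function.uncurry (spectrumFun (Mv := Mv) d₀ lam)) := by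
  have h := (contDiff_steeringVec Mv d₀ lam).continuous
  exact Complex.continuous_re.comp (continuous_sesquilinear h h)

lemma continuous_spectrumFunDeriv2 :
    Continuous (Function.uncurry (spectrumFunDeriv2 (Mv := Mv) d₀ lam)) := by
  have h := (contDiff_steeringVec Mv d₀ lam).continuous
  have h' := (contDiff_steeringDeriv Mv d₀ lam).continuous
  have h'' := (contDiff_steeringDeriv Mv d₀ lam).continuous_deriv le_rfl
  exact Complex.continuous_re.comp (((continuous_sesquilinear h'' h).add
    (continuous_sesquilinear h' h')).add ((continuous_sesquilinear h' h').add
    (continuous_sesquilinear h h'')))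

lemma isMusicEstimate_iff {S : Matrix (Fin Mv) (Fin Mv) ℂ} {est : Fin K → ℝ} :
    IsMusicEstimate d₀ lam S est ↔ ∃ U Λ, IsEigendecomp S U Λ ∧
      IsDeepestMinima (-(Real.pi / 2)) (Real.pi / 2)
        (spectrumFun d₀ lam (noiseProj U K)) est := by
  simp only [IsMusicEstimate, nullSpectrum_eq]
  rfl

lemma exists_isEigendecomp {n : ℕ} {S : Matrix (Fin n) (Fin n) ℂ} (hS : S.IsHermitian) :
    ∃ U Λ, IsEigendecomp S U Λ := by
  let V : Matrix (Fin n) (Fin n) ℂ := hS.eigenvectorUnitary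
  let σ := Tuple.sort (-hS.eigenvalues)
  have hV : V ∈ unitaryGroup (Fin n) ℂ := hS.eigenvectorUnitary.2
  refine ⟨V.submatrix id σ, hS.eigenvalues ∘ σ, ?_, ?_, ?_⟩
  · rw [mem_unitaryGroup_iff']
    change (V.submatrix id σ)ᴴ * V.submatrix id σ = 1
    rw [conjTranspose_submatrix, ← submatrix_mul _ _ _ id _ Function.bijective_id,
      show Vᴴ * V = 1 from mem_unitaryGroup_iff'.1 hV, submatrix_one_equiv]
  · intro i j hij
    have := Tuple.monotone_sort (-hS.eigenvalues) hij
    simpa using this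
  · have h1 : diagonal (fun i => (((hS.eigenvalues ∘ σ) i : ℝ) : ℂ)) =
        (diagonal fun i => (hS.eigenvalues i : ℂ)).submatrix σ σ :=
      (submatrix_diagonal_equiv (fun i => (hS.eigenvalues i : ℂ)) σ).symm
    rw [h1, conjTranspose_submatrix, submatrix_mul_equiv, submatrix_mul_equiv, submatrix_id_id]
    exact hS.spectral_theorem

lemma IsEigendecomp.smul {n : ℕ} {S U : Matrix (Fin n) (Fin n) ℂ} {Λ : Fin n → ℝ}
    (h : IsEigendecomp S U Λ) {c : ℝ} (hc : 0 ≤ c) :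
    IsEigendecomp ((c : ℂ) • S) U (fun i => c * Λ i) := by
  refine ⟨h.unitary, fun i j hij => mul_le_mul_of_nonneg_left (h.antitone hij) hc, ?_⟩
  have : diagonal (fun i => ((c * Λ i : ℝ) : ℂ)) = (c : ℂ) • diagonal (fun i => (Λ i : ℂ)) := by
    ext i j
    by_cases hij : i = j <;> simp [hij]
  rw [this, Matrix.mul_smul, Matrix.smul_mul, ← h.eq]

end NullSpectrum

/-! ### First-order error of MUSIC -/

section MusicError

variable {Mv K : ℕ} {d₀ lam : ℝ} {θ p : Fin K → ℝ}

lemma projPerp_mulVec_steeringVec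
    (hA : IsUnit ((steeringMat (ula Mv) d₀ lam θ)ᴴ * steeringMat (ula Mv) d₀ lam θ)) (k : Fin K) :
    projPerp (steeringMat (ula Mv) d₀ lam θ) *ᵥ steeringVec (ula Mv) d₀ lam (θ k) = 0 := by
  ext i
  have := congrFun (congrFun (projPerp_mul hA) i) k
  simpa [Matrix.mul_apply, mulVec, dotProduct, steeringMat] using this

lemma gamma_pos (hKMv : K < Mv) (hd₀ : 0 < d₀) (hlam : d₀ ≤ lam / 2)
    (hθ : Function.Injective θ)
    (hθ_range : ∀ k, θ k ∈ Set.Ioo (-(Real.pi / 2)) (Real.pi / 2)) (k : Fin K) :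
    0 < gamma Mv d₀ lam θ k :=
  re_quadForm_projPerp_pos (isUnit_gram_steeringMat hKMv hd₀ hlam hθ hθ_range)
    (steeringDeriv_notMem_range hKMv hd₀ hlam hθ hθ_range k)

lemma star_dotProduct_mulVec_swap {n : ℕ} {Q : Matrix (Fin n) (Fin n) ℂ} (hQ : Q.IsHermitian)
    (u v : Fin n → ℂ) : star u ⬝ᵥ (Q *ᵥ v) = star (star v ⬝ᵥ (Q *ᵥ u)) := by
  rw [← star_dotProduct_star, star_star, star_mulVec, hQ.eq, dotProduct_mulVec]

lemma spectrumFunDeriv_eq {Q : Matrix (Fin Mv) (Fin Mv) ℂ} (hQ : Q.IsHermitian) (x : ℝ) :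
    spectrumFunDeriv d₀ lam Q x = 2 *
      (star (steeringDeriv Mv d₀ lam x) ⬝ᵥ (Q *ᵥ steeringVec (ula Mv) d₀ lam x)).re := by
  rw [spectrumFunDeriv, star_dotProduct_mulVec_swap hQ (steeringVec (ula Mv) d₀ lam x),
    Complex.add_re, Complex.star_def, Complex.conj_re]
  ring

lemma spectrumFunDeriv2_projPerp
    (hA : IsUnit ((steeringMat (ula Mv) d₀ lam θ)ᴴ * steeringMat (ula Mv) d₀ lam θ)) (k : Fin K) :
    spectrumFunDeriv2 d₀ lam (projPerp (steeringMat (ula Mv) d₀ lam θ)) (θ k) =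
      2 * gamma Mv d₀ lam θ k := by
  rw [spectrumFunDeriv2, star_dotProduct_mulVec_swap (projPerp_isHermitian _)
    (steeringVec (ula Mv) d₀ lam (θ k)), projPerp_mulVec_steeringVec hA, gamma]
  simp
  ring

/-- MUSIC with a noise projector `Q̂ = Π + O(e)` such that `Q̂ A P = -Π E A†ᴴ + O(e²)`: the
estimates exist and have the error `(γₖ pₖ)⁻¹ Re(βₖᴴ E A†ᴴ eₖ)` to first order. -/
theorem deepestMinima_asymptotics (hKMv : K < Mv) (hd₀ : 0 < d₀) (hlam : d₀ ≤ lam / 2)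
    (hθ : Function.Injective θ)
    (hθ_range : ∀ k, θ k ∈ Set.Ioo (-(Real.pi / 2)) (Real.pi / 2)) (hp : ∀ k, 0 < p k)
    {ι : Type*} {l : Filter ι} {e : ι → ℝ} (he : Tendsto e l (𝓝 0))
    {Q E : ι → Matrix (Fin Mv) (Fin Mv) ℂ} (hQ : ∀ t, (Q t).IsHermitian) (hE : EntryBigO l E e)
    (h1 : EntryBigO l (fun t => Q t - projPerp (steeringMat (ula Mv) d₀ lam θ)) e)
    (h2 : EntryBigO l (fun t => Q t * steeringMat (ula Mv) d₀ lam θ *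
      diagonal (fun k => (p k : ℂ)) + projPerp (steeringMat (ula Mv) d₀ lam θ) * E t *
        (pinv (steeringMat (ula Mv) d₀ lam θ))ᴴ) (fun t => e t * e t)) :
    (∀ᶠ t in l, ∃ est, IsDeepestMinima (-(Real.pi / 2)) (Real.pi / 2)
      (spectrumFun d₀ lam (Q t)) est ∧ SameOrder θ est) ∧
    ∀ est : ι → Fin K → ℝ, (∀ᶠ t in l, IsDeepestMinima (-(Real.pi / 2)) (Real.pi / 2)
      (spectrumFun d₀ lam (Q t)) (est t) ∧ SameOrder θ (est t)) → ∀ k,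
      (fun t => est t k - θ k - (gamma Mv d₀ lam θ k * p k)⁻¹ *
        (star (beta Mv d₀ lam θ k) ⬝ᵥ
          (E t *ᵥ fun i => (pinv (steeringMat (ula Mv) d₀ lam θ))ᴴ i k)).re) =o[l] e := by
  have hA := isUnit_gram_steeringMat hKMv hd₀ hlam hθ hθ_range
  set A := steeringMat (ula Mv) d₀ lam θ with hAdef
  have hQlim : Tendsto Q l (𝓝 (projPerp A)) := by
    refine tendsto_pi_nhds.2 fun i => tendsto_pi_nhds.2 fun j => ?_
    exact tendsto_sub_nhds_zero_iff.1 ((h1 i j).trans_tendsto he)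
  have hγ := gamma_pos hKMv hd₀ hlam hθ hθ_range
  have hcurv : ∀ k, 0 < spectrumFunDeriv2 d₀ lam (projPerp A) (θ k) := fun k => by
    rw [spectrumFunDeriv2_projPerp hA]
    linarith [hγ k]
  have hloc := fun {δ : ℝ} (hδ : 0 < δ) => eventually_deepestMinima hθ hθ_range
    (continuous_spectrumFun (Mv := Mv) (d₀ := d₀) (lam := lam)) continuous_spectrumFunDeriv2
    hasDerivAt_spectrumFun hasDerivAt_spectrumFunDeriv (Q₀ := projPerp A)
    (fun k => by rw [spectrumFun, projPerp_mulVec_steeringVec hA]; simp)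
    (fun x hx hxθ => re_quadForm_projPerp_pos hA
      (steeringVec_notMem_range hKMv hd₀ hlam hθ_range hx hxθ)) hcurv hδ
  refine ⟨(hQlim.eventually (hloc one_pos)).mono fun t ht => ht.1, fun est hest k => ?_⟩
  have hlim : Tendsto (fun t => est t k) l (𝓝 (θ k)) := by
    refine Metric.tendsto_nhds.2 fun δ hδ => ?_
    filter_upwards [hest, hQlim.eventually (hloc hδ)] with t h3 h4
    exact h4.2 _ h3.1 h3.2 k
  have hcrit : ∀ᶠ t in l, spectrumFunDeriv d₀ lam (Q t) (est t k) = 0 := by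
    filter_upwards [hest] with t ht
    exact (ht.1.2.1 k).2.hasDerivAt_eq_zero (hasDerivAt_spectrumFun _ _)
  set b := fun t => (star (beta Mv d₀ lam θ k) ⬝ᵥ (E t *ᵥ fun i => (pinv A)ᴴ i k)).re with hb
  have hbO : b =O[l] e := by
    have : (fun t => star (beta Mv d₀ lam θ k) ⬝ᵥ (E t *ᵥ fun i => (pinv A)ᴴ i k)) =O[l] e := by
      simp only [dotProduct, mulVec]
      exact IsBigO.fun_sum fun i _ => (IsBigO.fun_sum fun j _ =>
        by simpa [mul_comm] using (hE i j).const_mul_left ((pinv A)ᴴ j k)).const_mul_left _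
    exact (IsBigO.of_bound 1 (Eventually.of_forall fun t => by
      rw [one_mul]; exact Complex.abs_re_le_norm _)).trans this
  -- the derivative of the null spectrum at `θ k`, up to second order
  have hDO : (fun t => spectrumFunDeriv d₀ lam (Q t) (θ k) * p k + 2 * b t) =O[l]
      fun t => e t * e t := by
    have h3 : (fun t => ∑ i, star (steeringDeriv Mv d₀ lam (θ k) i) *
        ((Q t * A * diagonal (fun k => (p k : ℂ)) + projPerp A * E t * (pinv A)ᴴ) i k)) =O[l]
        fun t => e t * e t :=
      IsBigO.fun_sum fun i _ => (h2 i k).const_mul_left _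
    have h4 : ∀ t, spectrumFunDeriv d₀ lam (Q t) (θ k) * p k + 2 * b t =
        2 * (∑ i, star (steeringDeriv Mv d₀ lam (θ k) i) * ((Q t * A *
          diagonal (fun k => (p k : ℂ)) + projPerp A * E t * (pinv A)ᴴ) i k)).re := by
      intro t
      have h5 : ∀ i, (Q t * A * diagonal (fun k => (p k : ℂ)) +
          projPerp A * E t * (pinv A)ᴴ) i k =
          (Q t *ᵥ steeringVec (ula Mv) d₀ lam (θ k)) i * p k +
          (projPerp A *ᵥ (E t *ᵥ fun i => (pinv A)ᴴ i k)) i := by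
        intro i
        rw [Matrix.add_apply, mul_diagonal, mulVec_mulVec]
        rfl
      have h6 : star (beta Mv d₀ lam θ k) ⬝ᵥ (E t *ᵥ fun i => (pinv A)ᴴ i k) =
          star (steeringDeriv Mv d₀ lam (θ k)) ⬝ᵥ
            (projPerp A *ᵥ (E t *ᵥ fun i => (pinv A)ᴴ i k)) := by
        rw [beta, star_mulVec_dotProduct, (projPerp_isHermitian _).eq]
      have h7 : ∑ i, star (steeringDeriv Mv d₀ lam (θ k) i) * ((Q t * A *
          diagonal (fun k => (p k : ℂ)) + projPerp A * E t * (pinv A)ᴴ) i k) =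
          (star (steeringDeriv Mv d₀ lam (θ k)) ⬝ᵥ
            (Q t *ᵥ steeringVec (ula Mv) d₀ lam (θ k))) * p k +
          star (steeringDeriv Mv d₀ lam (θ k)) ⬝ᵥ
            (projPerp A *ᵥ (E t *ᵥ fun i => (pinv A)ᴴ i k)) := by
        simp only [h5, dotProduct, Finset.sum_mul, ← Finset.sum_add_distrib, Pi.star_apply]
        exact Finset.sum_congr rfl fun i _ => by ring
      rw [h7, spectrumFunDeriv_eq (hQ t), hb]
      simp only [h6, Complex.add_re, Complex.re_mul_ofReal]
      ring
    simp only [h4]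
    refine IsBigO.const_mul_left ?_ 2
    exact (IsBigO.of_bound 1 (Eventually.of_forall fun t => by
      rw [one_mul]; exact Complex.abs_re_le_norm _)).trans h3
  have hee : (fun t => e t * e t) =o[l] e := by
    simpa using ((isLittleO_one_iff ℝ).2 he).mul_isBigO (isBigO_refl e l)
  have hpk := (hp k).ne'
  have hD : (fun t => spectrumFunDeriv d₀ lam (Q t) (θ k)) =O[l] e := by
    refine (((hDO.trans hee.isBigO).sub (hbO.const_mul_left 2)).const_mul_left
      (p k)⁻¹).congr_left fun t => ?_
    field_simp
    ring
  have hmain := isLittleO_critical_point_sub (continuous_spectrumFunDeriv2 (Mv := Mv) (d₀ := d₀)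
    (lam := lam)) hasDerivAt_spectrumFunDeriv (hcurv k).ne' hQlim hlim hcrit hD
  rw [spectrumFunDeriv2_projPerp hA] at hmain
  refine (hmain.sub ((hDO.trans_isLittleO hee).const_mul_left
    (2 * gamma Mv d₀ lam θ k * p k)⁻¹)).congr_left fun t => ?_
  have hγk := (hγ k).ne'
  field_simp
  ring

end MusicError

/-- `deepestMinima_asymptotics` for the MUSIC estimates from matrices `S t` whose noise projectors,
for every choice of the eigenvectors, have the required expansion. -/
theorem musicEstimate_asymptotics {Mv K : ℕ} {d₀ lam : ℝ} {θ p : Fin K → ℝ} (hKMv : K < Mv)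
    (hd₀ : 0 < d₀) (hlam : d₀ ≤ lam / 2) (hθ : Function.Injective θ)
    (hθ_range : ∀ k, θ k ∈ Set.Ioo (-(Real.pi / 2)) (Real.pi / 2)) (hp : ∀ k, 0 < p k)
    {ι : Type*} {l : Filter ι} [l.NeBot] {e : ι → ℝ} (he : Tendsto e l (𝓝 0))
    {S E : ι → Matrix (Fin Mv) (Fin Mv) ℂ} (hE : EntryBigO l E e)
    (hS : ∀ᶠ t in l, (S t).IsHermitian)
    (hpert : ∀ (U : ι → Matrix (Fin Mv) (Fin Mv) ℂ) (Λ : ι → Fin Mv → ℝ),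
      (∀ᶠ t in l, IsEigendecomp (S t) (U t) (Λ t)) →
      EntryBigO l (fun t => noiseProj (U t) K - projPerp (steeringMat (ula Mv) d₀ lam θ)) e ∧
      EntryBigO l (fun t => noiseProj (U t) K * steeringMat (ula Mv) d₀ lam θ *
        diagonal (fun k => (p k : ℂ)) + projPerp (steeringMat (ula Mv) d₀ lam θ) * E t *
          (pinv (steeringMat (ula Mv) d₀ lam θ))ᴴ) (fun t => e t * e t)) :
    (∀ᶠ t in l, ∃ est, IsMusicEstimate d₀ lam (S t) est ∧ SameOrder θ est) ∧
    ∀ est : ι → Fin K → ℝ,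
      (∀ᶠ t in l, IsMusicEstimate d₀ lam (S t) (est t) ∧ SameOrder θ (est t)) → ∀ k,
      (fun t => est t k - θ k - (gamma Mv d₀ lam θ k * p k)⁻¹ *
        (star (beta Mv d₀ lam θ k) ⬝ᵥ
          (E t *ᵥ fun i => (pinv (steeringMat (ula Mv) d₀ lam θ))ᴴ i k)).re) =o[l] e := by
  have hmain := fun (U : ι → Matrix (Fin Mv) (Fin Mv) ℂ) (Λ : ι → Fin Mv → ℝ)
      (h : ∀ᶠ t in l, IsEigendecomp (S t) (U t) (Λ t)) =>
    deepestMinima_asymptotics hKMv hd₀ hlam hθ hθ_range hp he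
      (fun t => noiseProj_isHermitian (U t) K) hE (hpert U Λ h).1 (hpert U Λ h).2
  constructor
  · obtain ⟨V, hV⟩ := Eventually.choice
      (r := fun t (V : Matrix (Fin Mv) (Fin Mv) ℂ × (Fin Mv → ℝ)) => IsEigendecomp (S t) V.1 V.2)
      (hS.mono fun t ht => by
        obtain ⟨U, Λ, h⟩ := exists_isEigendecomp ht
        exact ⟨(U, Λ), h⟩)
    filter_upwards [hV, (hmain (fun t => (V t).1) (fun t => (V t).2) hV).1] with t h1 h2
    obtain ⟨est, h3, h4⟩ := h2
    exact ⟨est, isMusicEstimate_iff.2 ⟨_, _, h1, h3⟩, h4⟩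
  · intro est hest
    obtain ⟨V, hV⟩ := Eventually.choice
      (r := fun t (V : Matrix (Fin Mv) (Fin Mv) ℂ × (Fin Mv → ℝ)) =>
        IsEigendecomp (S t) V.1 V.2 ∧ IsDeepestMinima (-(Real.pi / 2)) (Real.pi / 2)
          (spectrumFun d₀ lam (noiseProj V.1 K)) (est t))
      (hest.mono fun t ht => by
        obtain ⟨U, Λ, h⟩ := isMusicEstimate_iff.1 ht.1
        exact ⟨(U, Λ), h⟩)
    exact (hmain (fun t => (V t).1) (fun t => (V t).2) (hV.mono fun t ht => ht.1)).2 est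
      ((hV.and hest).mono fun t ht => ⟨ht.1.2, ht.2.2⟩)

/-! ### The augmented covariance matrix -/

section Augmented

variable {M K Mv : ℕ} {d : Fin M → ℤ}

lemma subSel_mulVec (i r : Fin Mv) (z : Fin (2 * Mv - 1) → ℂ) :
    (subSel Mv i *ᵥ z) r = z ⟨i + r, by omega⟩ := by
  rw [mulVec, dotProduct, Finset.sum_eq_single ⟨i + r, by omega⟩]
  · simp [subSel]
  · intro c _ hc
    have : ¬ (c : ℕ) = i + r := fun h => hc (Fin.ext h)
    simp [subSel, this]
  · simp

/-- The entries of the augmented matrix average the entries of `D` over the sensor pairs with the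
same difference. -/
lemma directAug_apply (D : Matrix (Fin M) (Fin M) ℂ) (r c : Fin Mv) :
    directAug d Mv D r c = ∑ m, ∑ n, if d m - d n = (r : ℤ) - c then
      (1 / (weight d ((r : ℤ) - c) : ℂ)) * D m n else 0 := by
  have hidx : (((c.rev : ℕ) + (r : ℕ) : ℕ) : ℤ) + 1 - Mv = (r : ℤ) - c := by
    rw [Fin.val_rev]
    omega
  rw [directAug, of_apply, subSel_mulVec, virtualObs, mulVec, dotProduct, Fintype.sum_prod_type,
    Finset.sum_comm]
  refine Finset.sum_congr rfl fun m _ => Finset.sum_congr rfl fun n _ => ?_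
  simp only [selMat, of_apply, hidx, vec]
  split_ifs <;> simp

lemma directAug_add (D D' : Matrix (Fin M) (Fin M) ℂ) :
    directAug d Mv (D + D') = directAug d Mv D + directAug d Mv D' := by
  ext r c
  simp only [Matrix.add_apply, directAug_apply, ← Finset.sum_add_distrib]
  refine Finset.sum_congr rfl fun m _ => Finset.sum_congr rfl fun n _ => ?_
  split_ifs <;> ring

lemma weight_neg (d : Fin M → ℤ) (l : ℤ) : weight d (-l) = weight d l := by
  rw [weight, weight]
  refine Finset.card_equiv (Equiv.prodComm _ _) fun mn => ?_
  simp only [Finset.mem_filter, Finset.mem_univ, true_and, Equiv.prodComm_apply, Prod.fst_swap,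
    Prod.snd_swap]
  omega

lemma directAug_isHermitian {D : Matrix (Fin M) (Fin M) ℂ} (hD : D.IsHermitian) :
    (directAug d Mv D).IsHermitian := by
  ext r c
  rw [conjTranspose_apply, directAug_apply, directAug_apply, Finset.sum_comm, star_sum]
  refine Finset.sum_congr rfl fun m _ => ?_
  rw [star_sum]
  refine Finset.sum_congr rfl fun n _ => ?_
  have h1 : ((c : ℤ) - r) = -((r : ℤ) - c) := by ring
  have h2 : (d n - d m = -((r : ℤ) - c)) ↔ (d m - d n = (r : ℤ) - c) := by omega
  simp only [h1, h2, weight_neg]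
  split_ifs
  · rw [← hD.apply m n]
    simp
  · simp

lemma weight_ne_zero (hMv : ContainsULA d Mv) (r c : Fin Mv) :
    weight d ((r : ℤ) - c) ≠ 0 := by
  obtain ⟨m, n, h⟩ := hMv ((r : ℤ) - c) (by rw [abs_lt]; omega)
  rw [weight, Finset.card_ne_zero]
  exact ⟨(m, n), by simpa using h⟩

lemma directAug_of_stationary (hMv : ContainsULA d Mv) {D : Matrix (Fin M) (Fin M) ℂ} {g : ℤ → ℂ}
    (hD : ∀ m n, D m n = g (d m - d n)) (r c : Fin Mv) :
    directAug d Mv D r c = g ((r : ℤ) - c) := by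
  have hw : (weight d ((r : ℤ) - c) : ℂ) ≠ 0 := Nat.cast_ne_zero.2 (weight_ne_zero hMv r c)
  have h : ∀ m n, (if d m - d n = (r : ℤ) - c then
      (1 / (weight d ((r : ℤ) - c) : ℂ)) * D m n else 0) =
      if d m - d n = (r : ℤ) - c then
        (1 / (weight d ((r : ℤ) - c) : ℂ)) * g ((r : ℤ) - c) else 0 := by
    intro m n
    split_ifs with hmn
    · rw [hD, hmn]
    · rfl
  simp only [directAug_apply, h]
  rw [← Fintype.sum_prod_type' (f := fun m n => if d m - d n = (r : ℤ) - c then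
    (1 / (weight d ((r : ℤ) - c) : ℂ)) * g ((r : ℤ) - c) else 0), ← Finset.sum_filter,
    Finset.sum_const, nsmul_eq_mul]
  change (weight d ((r : ℤ) - c) : ℂ) * _ = _
  field_simp

lemma covariance_apply {N : ℕ} {δ : Fin N → ℤ} (hδ : Function.Injective δ) (d₀ lam : ℝ)
    (θ p : Fin K → ℝ) (σsq : ℝ) (m n : Fin N) :
    covariance δ d₀ lam θ p σsq m n =
      ∑ k, (p k : ℂ) * Complex.exp (Complex.I * ((δ m - δ n : ℤ) : ℂ) * (phase d₀ lam (θ k) : ℂ)) +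
        if δ m - δ n = 0 then (σsq : ℂ) else 0 := by
  have h1 : (δ m - δ n = 0) ↔ m = n := by rw [sub_eq_zero, hδ.eq_iff]
  rw [covariance, Matrix.add_apply, Matrix.mul_apply]
  simp only [h1, mul_diagonal, conjTranspose_apply, steeringMat, of_apply, steeringVec,
    Matrix.smul_apply, one_apply, smul_eq_mul, mul_ite, mul_one, mul_zero]
  congr 1
  refine Finset.sum_congr rfl fun k _ => ?_
  rw [Complex.star_def, ← Complex.exp_conj, mul_right_comm, ← Complex.exp_add, mul_comm]
  congr 2
  simp
  ring

lemma covariance_isHermitian {N : ℕ} (δ : Fin N → ℤ) (d₀ lam : ℝ) (θ p : Fin K → ℝ) (σsq : ℝ) :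
    (covariance δ d₀ lam θ p σsq).IsHermitian := by
  refine IsHermitian.add (isHermitian_mul_mul_conjTranspose _ ?_) ?_
  · rw [IsHermitian, diagonal_conjTranspose]
    congr 1
    ext k
    simp
  · rw [IsHermitian, conjTranspose_smul, conjTranspose_one]
    simp

/-- Direct augmentation turns the covariance matrix of the array into that of the virtual uniform
linear array. -/
lemma directAug_covariance (hd : Function.Injective d) (hMv : ContainsULA d Mv) (d₀ lam : ℝ)
    (θ p : Fin K → ℝ) (σsq : ℝ) :
    directAug d Mv (covariance d d₀ lam θ p σsq) = covariance (ula Mv) d₀ lam θ p σsq := by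
  ext r c
  rw [directAug_of_stationary hMv (g := fun l => ∑ k, (p k : ℂ) *
    Complex.exp (Complex.I * (l : ℂ) * (phase d₀ lam (θ k) : ℂ)) +
      if l = 0 then (σsq : ℂ) else 0) (covariance_apply hd d₀ lam θ p σsq), covariance_apply]
  · rfl
  · intro i j hij
    simpa [ula, Fin.ext_iff] using hij

/-- Spatial smoothing squares the augmented matrix, up to the factor `1 / Mv`. -/
lemma smul_spatialSmooth (hMv : 0 < Mv) {D : Matrix (Fin M) (Fin M) ℂ} (hD : D.IsHermitian) :
    ((Mv : ℝ) : ℂ) • spatialSmooth d Mv D = directAug d Mv D * directAug d Mv D := by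
  have hMv' : (Mv : ℂ) ≠ 0 := Nat.cast_ne_zero.2 hMv.ne'
  rw [spatialSmooth, smul_smul, Complex.ofReal_natCast, mul_one_div_cancel hMv', one_smul]
  nth_rw 2 [← (directAug_isHermitian (d := d) (Mv := Mv) hD).eq]
  ext r s
  rw [Matrix.sum_apply, Matrix.mul_apply, ← Equiv.sum_comp Fin.revPerm]
  rfl

lemma spatialSmooth_isHermitian (D : Matrix (Fin M) (Fin M) ℂ) :
    (spatialSmooth d Mv D).IsHermitian := by
  ext r s
  rw [conjTranspose_apply, spatialSmooth, Matrix.smul_apply, Matrix.smul_apply, Matrix.sum_apply,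
    Matrix.sum_apply, star_smul, star_sum]
  congr 1
  · simp
  · exact Finset.sum_congr rfl fun i _ => by simp [vecMulVec_apply, mul_comm]

lemma entryBigO_directAug {ι : Type*} {l : Filter ι} {D : ι → Matrix (Fin M) (Fin M) ℂ}
    (d : Fin M → ℤ) (Mv : ℕ) :
    EntryBigO l (fun t => directAug d Mv (D t)) (fun t => ‖(D t).vec‖) := by
  intro r c
  simp only [directAug_apply]
  refine IsBigO.fun_sum fun m _ => IsBigO.fun_sum fun n _ => ?_
  split_ifs
  · exact (IsBigO.of_bound 1 (Eventually.of_forall fun t => by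
      simpa using norm_le_pi_norm (D t).vec (n, m))).const_mul_left _
  · exact isBigO_zero _ _

/-- The pairing `ξₖᵀ Δr` in terms of the augmented matrix of the perturbation. -/
lemma re_xi_dotProduct_vec {d₀ lam : ℝ} {θ : Fin K → ℝ} {D : Matrix (Fin M) (Fin M) ℂ}
    (hD : D.IsHermitian) (k : Fin K) :
    (xi d Mv d₀ lam θ k ⬝ᵥ D.vec).re = -(star (beta Mv d₀ lam θ k) ⬝ᵥ
      (directAug d Mv D *ᵥ fun i => (pinv (steeringMat (ula Mv) d₀ lam θ))ᴴ i k)).re := by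
  have h1 : xi d Mv d₀ lam θ k ⬝ᵥ D.vec =
      star (star (alpha Mv d₀ lam θ k)) ⬝ᵥ (directAug d Mv D *ᵥ beta Mv d₀ lam θ k) := by
    rw [xi, mulVec_transpose, mulVec_transpose, ← dotProduct_mulVec, ← dotProduct_mulVec, star_star]
    change _ ⬝ᵥ (stackSel Mv *ᵥ virtualObs d Mv D) = _
    have h2 : ∀ b r, (stackSel Mv *ᵥ virtualObs d Mv D) (b, r) = directAug d Mv D r b :=
      fun b r => rfl
    generalize stackSel Mv *ᵥ virtualObs d Mv D = z at h2
    simp only [dotProduct, mulVec, Finset.mul_sum]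
    rw [Fintype.sum_prod_type, Finset.sum_comm]
    refine Finset.sum_congr rfl fun r _ => Finset.sum_congr rfl fun b _ => ?_
    rw [h2, kronVec]
    ring
  have h3 : (fun i => (pinv (steeringMat (ula Mv) d₀ lam θ))ᴴ i k) =
      -star (alpha Mv d₀ lam θ k) := by
    ext i
    simp [alpha]
  rw [h1, h3, star_dotProduct_mulVec_swap (directAug_isHermitian hD), mulVec_neg, dotProduct_neg,
    Complex.neg_re, neg_neg, Complex.star_def, Complex.conj_re]

/-- Existence and first-order error of both estimates, for covariance estimates that converge to
the covariance matrix along an arbitrary filter. -/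
theorem estimates_asymptotics (hd : Function.Injective d) (hMv : ContainsULA d Mv) (hK : K < Mv)
    {d₀ lam : ℝ} (hd₀ : 0 < d₀) (hlam : d₀ ≤ lam / 2) {θ : Fin K → ℝ} (hθ : Function.Injective θ)
    (hθ_range : ∀ k, θ k ∈ Set.Ioo (-(Real.pi / 2)) (Real.pi / 2))
    {p : Fin K → ℝ} (hp : ∀ k, 0 < p k) {σsq : ℝ} (hσ : 0 ≤ σsq)
    {ι : Type*} {l : Filter ι} [l.NeBot] {Rhat : ι → Matrix (Fin M) (Fin M) ℂ}
    (hRhat : Tendsto Rhat l (𝓝[{H | H.IsHermitian}] (covariance d d₀ lam θ p σsq))) :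
    (∀ᶠ t in l, (∃ est, IsDAMusic d Mv d₀ lam θ (Rhat t) est) ∧
      ∃ est, IsSSMusic d Mv d₀ lam θ (Rhat t) est) ∧
    ∀ est₁ est₂ : ι → Fin K → ℝ,
      (∀ᶠ t in l, IsDAMusic d Mv d₀ lam θ (Rhat t) (est₁ t)) →
      (∀ᶠ t in l, IsSSMusic d Mv d₀ lam θ (Rhat t) (est₂ t)) → ∀ k,
      FirstOrderEq l (fun t => (Rhat t - covariance d d₀ lam θ p σsq).vec)
        (fun t => est₁ t k - θ k) (fun t => est₂ t k - θ k) ∧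
      FirstOrderEq l (fun t => (Rhat t - covariance d d₀ lam θ p σsq).vec)
        (fun t => est₂ t k - θ k) (fun t => firstOrderError d Mv d₀ lam θ p k
          (Rhat t - covariance d d₀ lam θ p σsq).vec) := by
  set R := covariance d d₀ lam θ p σsq with hR
  have hherm : ∀ᶠ t in l, (Rhat t).IsHermitian :=
    hRhat.eventually (eventually_mem_nhdsWithin)
  have hlim : Tendsto Rhat l (𝓝 R) := hRhat.mono_right nhdsWithin_le_nhds
  have hRherm : R.IsHermitian := covariance_isHermitian d d₀ lam θ p σsq
  have he : Tendsto (fun t => ‖(Rhat t - R).vec‖) l (𝓝 0) := by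
    have h1 : Continuous fun D : Matrix (Fin M) (Fin M) ℂ => ‖(D - R).vec‖ := by
      refine continuous_norm.comp (continuous_pi fun ij => ?_)
      exact (continuous_id.matrix_elem ij.2 ij.1).sub continuous_const
    simpa [Function.comp_def] using (h1.tendsto R).comp hlim
  have hE := entryBigO_directAug (l := l) (D := fun t => Rhat t - R) d Mv
  have haug : ∀ t, directAug d Mv (Rhat t) = steeringMat (ula Mv) d₀ lam θ *
      diagonal (fun k => (p k : ℂ)) * (steeringMat (ula Mv) d₀ lam θ)ᴴ +
      (σsq : ℂ) • (1 : Matrix (Fin Mv) (Fin Mv) ℂ) + directAug d Mv (Rhat t - R) := by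
    intro t
    have h1 : Rhat t = R + (Rhat t - R) := by abel
    conv_lhs => rw [h1, directAug_add, hR, directAug_covariance hd hMv, covariance]
  have hA := isUnit_gram_steeringMat hK hd₀ hlam hθ hθ_range
  obtain ⟨hex₁, herr₁⟩ := musicEstimate_asymptotics hK hd₀ hlam hθ hθ_range hp he hE
    (S := fun t => directAug d Mv (Rhat t)) (hherm.mono fun t ht => directAug_isHermitian ht)
    fun U Λ h => noiseProj_perturbation_of_add hK.le hA hp hE (h.mono fun t ht => haug t ▸ ht)
  obtain ⟨hex₂, herr₂⟩ := musicEstimate_asymptotics hK hd₀ hlam hθ hθ_range hp he hE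
    (S := fun t => spatialSmooth d Mv (Rhat t))
    (Eventually.of_forall fun t => spatialSmooth_isHermitian _)
    fun U Λ h => noiseProj_perturbation_of_sq hK.le hA hp hσ hE (he.isBigO_one ℝ)
      (Λ := fun t i => Mv * Λ t i) ((h.and hherm).mono fun t ht => by
        have h1 := ht.1.smul (Nat.cast_nonneg (α := ℝ) Mv)
        rwa [smul_spatialSmooth (by omega) ht.2, haug t] at h1)
  refine ⟨hex₁.and hex₂, fun est₁ est₂ h₁ h₂ k => ?_⟩
  have h3 := herr₁ est₁ h₁ k
  have h4 := herr₂ est₂ h₂ k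
  have h5 : (fun t => est₁ t k - θ k - (est₂ t k - θ k)) =o[l] fun t => ‖(Rhat t - R).vec‖ :=
    (h3.sub h4).congr_left fun t => by ring
  have h6 : (fun t => est₂ t k - θ k - firstOrderError d Mv d₀ lam θ p k (Rhat t - R).vec) =o[l]
      fun t => ‖(Rhat t - R).vec‖ := by
    refine h4.congr' (hherm.mono fun t ht => ?_) (EventuallyEq.refl _ _)
    simp only [firstOrderError, re_xi_dotProduct_vec (ht.sub hRherm)]
    ring
  exact ⟨isLittleO_norm_right.1 h5, isLittleO_norm_right.1 h6⟩

end Augmented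

/-! ### Strong law of large numbers for the sample covariance matrix -/

section CircGaussian

lemma integral_sq_gaussianReal (v : ℝ) (hv : 0 ≤ v) :
    ∫ x, x ^ 2 ∂gaussianReal 0 v.toNNReal = v := by
  have h := variance_id_gaussianReal (μ := 0) (v := v.toNNReal)
  rw [variance_of_integral_eq_zero aemeasurable_id (by simp)] at h
  simpa [hv] using h

lemma measurable_ofReal_add_ofReal_mul_I :
    Measurable fun w : ℝ × ℝ => (w.1 : ℂ) + (w.2 : ℂ) * Complex.I := by fun_prop

lemma memLp_fst_gaussian_prod (v : ℝ) : MemLp (fun w : ℝ × ℝ => w.1) 2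
    ((gaussianReal 0 v.toNNReal).prod (gaussianReal 0 v.toNNReal)) :=
  (memLp_id_gaussianReal 2).comp_fst _

lemma memLp_snd_gaussian_prod (v : ℝ) : MemLp (fun w : ℝ × ℝ => w.2) 2
    ((gaussianReal 0 v.toNNReal).prod (gaussianReal 0 v.toNNReal)) :=
  (memLp_id_gaussianReal 2).comp_snd _

lemma memLp_ofReal_fst_gaussian_prod (v : ℝ) : MemLp (fun w : ℝ × ℝ => (w.1 : ℂ)) 2
    ((gaussianReal 0 v.toNNReal).prod (gaussianReal 0 v.toNNReal)) :=
  Complex.ofRealCLM.comp_memLp' (memLp_fst_gaussian_prod v)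

lemma memLp_ofReal_snd_mul_I_gaussian_prod (v : ℝ) :
    MemLp (fun w : ℝ × ℝ => (w.2 : ℂ) * Complex.I) 2
      ((gaussianReal 0 v.toNNReal).prod (gaussianReal 0 v.toNNReal)) :=
  MemLp.mul_const (f := fun w : ℝ × ℝ => (w.2 : ℂ))
    (Complex.ofRealCLM.comp_memLp' (memLp_snd_gaussian_prod v)) Complex.I

lemma memLp_id_circGaussian (v : ℝ) : MemLp id 2 (circGaussian v) := by
  rw [circGaussian, memLp_map_measure_iff aestronglyMeasurable_id
    measurable_ofReal_add_ofReal_mul_I.aemeasurable]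
  exact (memLp_ofReal_fst_gaussian_prod _).add (memLp_ofReal_snd_mul_I_gaussian_prod _)

lemma integral_id_circGaussian (v : ℝ) : ∫ z, z ∂circGaussian v = 0 := by
  rw [circGaussian, integral_map measurable_ofReal_add_ofReal_mul_I.aemeasurable
    (by fun_prop), integral_add
    ((memLp_ofReal_fst_gaussian_prod _).integrable one_le_two)
    ((memLp_ofReal_snd_mul_I_gaussian_prod _).integrable one_le_two),
    integral_mul_const, integral_complex_ofReal, integral_complex_ofReal,
    integral_fun_fst (fun x : ℝ => x), integral_fun_snd (fun x : ℝ => x)]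
  simp [integral_id_gaussianReal]

lemma integral_mul_star_circGaussian {v : ℝ} (hv : 0 ≤ v) :
    ∫ z, z * star z ∂circGaussian v = v := by
  have h : ∀ w : ℝ × ℝ, ((w.1 : ℂ) + (w.2 : ℂ) * Complex.I) *
      star ((w.1 : ℂ) + (w.2 : ℂ) * Complex.I) = ((w.1 ^ 2 + w.2 ^ 2 : ℝ) : ℂ) := by
    intro w
    rw [Complex.star_def, Complex.mul_conj, Complex.normSq_add_mul_I]
  rw [circGaussian, integral_map measurable_ofReal_add_ofReal_mul_I.aemeasurable
    (by fun_prop)]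
  simp only [h]
  rw [integral_complex_ofReal, integral_add (memLp_fst_gaussian_prod _).integrable_sq
    (memLp_snd_gaussian_prod _).integrable_sq, integral_fun_fst (fun x : ℝ => x ^ 2),
    integral_fun_snd (fun x : ℝ => x ^ 2), integral_sq_gaussianReal _ (by linarith)]
  simp

end CircGaussian

section SampleCovariance

variable {Ω : Type*}

/-- The empirical covariances of independent circular Gaussian variables converge almost surely. -/
lemma ae_tendsto_empirical_covariance [MeasurableSpace Ω] {μ : Measure Ω}
    [IsProbabilityMeasure μ] {κ : Type*} [DecidableEq κ] {W : ℕ → κ → Ω → ℂ}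
    {v : κ → ℝ}
    (hv : ∀ a, 0 ≤ v a) (hlaw : ∀ t a, HasLaw (W t a) (circGaussian (v a)) μ)
    (hind : iIndepFun (fun i : ℕ × κ => W i.1 i.2) μ) (a b : κ) :
    ∀ᵐ ω ∂μ, Tendsto (fun N : ℕ => (1 / (N : ℂ)) *
      ∑ t ∈ Finset.range N, W t a ω * star (W t b ω)) atTop (𝓝 (if a = b then (v a : ℂ) else 0)) := by
  have hL2 : ∀ t c, MemLp (W t c) 2 μ := fun t c => by
    have h := memLp_id_circGaussian (v c)
    rw [← (hlaw t c).map_eq, memLp_map_measure_iff aestronglyMeasurable_id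
      (hlaw t c).aemeasurable] at h
    exact h
  have hid : ∀ t c, IdentDistrib (W t c) (W 0 c) μ μ := fun t c =>
    ⟨(hlaw t c).aemeasurable, (hlaw 0 c).aemeasurable, by
      rw [(hlaw t c).map_eq, (hlaw 0 c).map_eq]⟩
  have hφ : Measurable fun z : ℂ × ℂ => z.1 * star z.2 := by fun_prop
  have hmeas : ∀ i : ℕ × κ, AEMeasurable (W i.1 i.2) μ := fun i => (hlaw i.1 i.2).aemeasurable
  have hpair : ∀ t, a ≠ b → IndepFun (W t a) (W t b) μ := fun t hab =>
    hind.indepFun (i := (t, a)) (j := (t, b)) (by simpa using hab)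
  have hint : Integrable (fun ω => W 0 a ω * star (W 0 b ω)) μ :=
    (hL2 0 a).integrable_mul (hL2 0 b).star
  have hE : ∫ ω, W 0 a ω * star (W 0 b ω) ∂μ = if a = b then (v a : ℂ) else 0 := by
    split_ifs with hab
    · subst hab
      rw [← integral_mul_star_circGaussian (hv a)]
      exact (hlaw 0 a).integral_comp (f := fun z => z * star z) (by fun_prop)
    · have h1 : IndepFun (W 0 a) (fun ω => star (W 0 b ω)) μ :=
        (hpair 0 hab).comp measurable_id (continuous_star.measurable)
      rw [h1.integral_fun_mul_eq_mul_integral (hlaw 0 a).aemeasurable.aestronglyMeasurable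
        (by have := (hlaw 0 b).aemeasurable; fun_prop), (hlaw 0 a).integral_eq,
        integral_id_circGaussian, zero_mul]
  have hslln := strong_law_ae (fun t ω => W t a ω * star (W t b ω)) hint
    (fun t s hts => (hind.indepFun_prodMk_prodMk₀ hmeas (t, a) (t, b) (s, a) (s, b)
      (by simp [hts]) (by simp [hts]) (by simp [hts]) (by simp [hts])).comp hφ hφ)
    (fun t => by
      by_cases hab : a = b
      · subst hab
        exact (hid t a).comp (u := fun z => z * star z) (by fun_prop)
      · exact ((hid t a).prodMk (hid t b) (hpair t hab) (hpair 0 hab)).comp hφ)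
  rw [hE] at hslln
  filter_upwards [hslln] with ω hω
  refine hω.congr fun N => ?_
  rw [Complex.real_smul]
  simp

variable {M K : ℕ}

/-- Array response to the vector of all source signals and noise terms. -/
noncomputable def responseMat (d : Fin M → ℤ) (d₀ lam : ℝ) (θ : Fin K → ℝ) :
    Matrix (Fin M) (Fin K ⊕ Fin M) ℂ := fromCols (steeringMat d d₀ lam θ) 1

lemma covariance_eq_responseMat (d : Fin M → ℤ) (d₀ lam : ℝ) (θ p : Fin K → ℝ) (σsq : ℝ) :
    covariance d d₀ lam θ p σsq = responseMat d d₀ lam θ *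
      (diagonal (fun a => ((Sum.elim p (fun _ => σsq) a : ℝ) : ℂ)) :
        Matrix (Fin K ⊕ Fin M) (Fin K ⊕ Fin M) ℂ) * (responseMat d d₀ lam θ)ᴴ := by
  ext m n
  rw [covariance, Matrix.add_apply, Matrix.mul_apply, Matrix.mul_apply, Fintype.sum_sum_type]
  congr 1
  · simp [responseMat, mul_diagonal]
  · by_cases hmn : m = n <;> simp [responseMat, mul_diagonal, one_apply, hmn]

lemma sampleCov_eq_responseMat (d : Fin M → ℤ) (d₀ lam : ℝ) (θ : Fin K → ℝ)
    (x : ℕ → Fin K → Ω → ℂ) (n : ℕ → Fin M → Ω → ℂ) (N : ℕ) (ω : Ω) :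
    sampleCov d d₀ lam θ x n N ω = responseMat d d₀ lam θ *
      (Matrix.of fun a b => (1 / (N : ℂ)) * ∑ t ∈ Finset.range N,
        Sum.elim (x t) (n t) a ω * star (Sum.elim (x t) (n t) b ω)) *
        (responseMat d d₀ lam θ)ᴴ := by
  have h1 : ∀ t, snapshot d d₀ lam θ x n t ω =
      responseMat d d₀ lam θ *ᵥ fun a => Sum.elim (x t) (n t) a ω := by
    intro t
    have : (fun a => Sum.elim (x t) (n t) a ω) =
        Sum.elim (fun k => x t k ω) (fun m => n t m ω) := by
      ext a
      cases a <;> rfl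
    rw [this, responseMat, fromCols_mulVec_sumElim, one_mulVec, snapshot]
  have h2 : (Matrix.of fun a b => (1 / (N : ℂ)) * ∑ t ∈ Finset.range N,
      Sum.elim (x t) (n t) a ω * star (Sum.elim (x t) (n t) b ω)) =
      (1 / (N : ℂ)) • ∑ t ∈ Finset.range N, vecMulVec (fun a => Sum.elim (x t) (n t) a ω)
        (star fun a => Sum.elim (x t) (n t) a ω) := by
    ext a b
    simp [Matrix.sum_apply, vecMulVec_apply]
  rw [h2, sampleCov, Matrix.mul_smul, Matrix.smul_mul, Matrix.mul_sum, Matrix.sum_mul]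
  simp only [h1, mul_vecMulVec, vecMulVec_mul, star_mulVec]

lemma sampleCov_isHermitian (d : Fin M → ℤ) (d₀ lam : ℝ) (θ : Fin K → ℝ)
    (x : ℕ → Fin K → Ω → ℂ) (n : ℕ → Fin M → Ω → ℂ) (N : ℕ) (ω : Ω) :
    (sampleCov d d₀ lam θ x n N ω).IsHermitian := by
  ext r s
  rw [conjTranspose_apply, sampleCov, Matrix.smul_apply, Matrix.smul_apply, Matrix.sum_apply,
    Matrix.sum_apply, star_smul, star_sum]
  congr 1
  · simp
  · exact Finset.sum_congr rfl fun i _ => by simp [vecMulVec_apply, mul_comm]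

/-- Consistency of the sample covariance matrix. -/
theorem ae_tendsto_sampleCov [MeasurableSpace Ω] {μ : Measure Ω} [IsProbabilityMeasure μ]
    (d : Fin M → ℤ) (d₀ lam : ℝ) (θ : Fin K → ℝ) {p : Fin K → ℝ}
    (hp : ∀ k, 0 < p k) {σsq : ℝ} (hσ : 0 ≤ σsq) {x : ℕ → Fin K → Ω → ℂ}
    {n : ℕ → Fin M → Ω → ℂ} (h : IsSnapshotModel μ p σsq x n) :
    ∀ᵐ ω ∂μ, Tendsto (fun N => sampleCov d d₀ lam θ x n N ω) atTop
      (𝓝[{H | H.IsHermitian}] (covariance d d₀ lam θ p σsq)) := by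
  have h1 : ∀ a b : Fin K ⊕ Fin M, ∀ᵐ ω ∂μ, Tendsto (fun N : ℕ => (1 / (N : ℂ)) *
      ∑ t ∈ Finset.range N, Sum.elim (x t) (n t) a ω * star (Sum.elim (x t) (n t) b ω)) atTop
        (𝓝 (if a = b then ((Sum.elim p (fun _ => σsq) a : ℝ) : ℂ) else 0)) :=
    ae_tendsto_empirical_covariance (W := fun t => Sum.elim (x t) (n t))
      (fun a => by
        cases a with
        | inl k => exact (hp k).le
        | inr m => exact hσ)
      (fun t a => by
        cases a with
        | inl k => exact h.source_law t k
        | inr m => exact h.noise_law t m) h.indep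
  filter_upwards [ae_all_iff.2 fun a => ae_all_iff.2 (h1 a)] with ω hω
  refine tendsto_nhdsWithin_iff.2 ⟨?_, Eventually.of_forall fun N =>
    sampleCov_isHermitian d d₀ lam θ x n N ω⟩
  simp only [sampleCov_eq_responseMat, covariance_eq_responseMat]
  have hcont : Continuous fun C : Matrix (Fin K ⊕ Fin M) (Fin K ⊕ Fin M) ℂ =>
      responseMat d d₀ lam θ * C * (responseMat d d₀ lam θ)ᴴ :=
    (continuous_const.matrix_mul continuous_id).matrix_mul continuous_const
  refine (hcont.tendsto _).comp (tendsto_pi_nhds.2 fun a => tendsto_pi_nhds.2 fun b => ?_)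
  exact hω a b

end SampleCovariance

end Coarray

theorem theorem1 {M K Mv : ℕ} (d : Fin M → ℤ) (hd : Function.Injective d)
    (hMv : ContainsULA d Mv) (hK : K < Mv)
    (d₀ lam : ℝ) (hd₀ : 0 < d₀) (hlam : d₀ ≤ lam / 2)
    (θ : Fin K → ℝ) (hθ : Function.Injective θ)
    (hθ_range : ∀ k, θ k ∈ Set.Ioo (-(Real.pi / 2)) (Real.pi / 2))
    (p : Fin K → ℝ) (hp : ∀ k, 0 < p k) (σsq : ℝ) (hσ : 0 ≤ σsq)
    (R : Matrix (Fin M) (Fin M) ℂ) (hR : R = covariance d d₀ lam θ p σsq) :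
    -- the inverse in the error expression is a genuine one
    (∀ k, 0 < gamma Mv d₀ lam θ k) ∧
    -- for small Hermitian perturbations of the covariance matrix both estimates exist,
    (∀ᶠ Rhat in 𝓝[{H | H.IsHermitian}] R,
      (∃ est, IsDAMusic d Mv d₀ lam θ Rhat est) ∧ ∃ est, IsSSMusic d Mv d₀ lam θ Rhat est) ∧
    -- and have the stated error, to first order in the perturbation
    (∀ est₁ est₂ : Matrix (Fin M) (Fin M) ℂ → Fin K → ℝ,
      (∀ᶠ Rhat in 𝓝[{H | H.IsHermitian}] R, IsDAMusic d Mv d₀ lam θ Rhat (est₁ Rhat)) →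
      (∀ᶠ Rhat in 𝓝[{H | H.IsHermitian}] R, IsSSMusic d Mv d₀ lam θ Rhat (est₂ Rhat)) →
      ∀ k,
        FirstOrderEq (𝓝[{H | H.IsHermitian}] R) (fun Rhat => (Rhat - R).vec)
          (fun Rhat => est₁ Rhat k - θ k) (fun Rhat => est₂ Rhat k - θ k) ∧
        FirstOrderEq (𝓝[{H | H.IsHermitian}] R) (fun Rhat => (Rhat - R).vec)
          (fun Rhat => est₂ Rhat k - θ k)
          (fun Rhat => firstOrderError d Mv d₀ lam θ p k (Rhat - R).vec)) ∧
    -- the same for the sample covariance matrix, almost surely as the number of snapshots grows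
    (∀ (Ω : Type*) [MeasurableSpace Ω] (μ : Measure Ω) [IsProbabilityMeasure μ]
      (x : ℕ → Fin K → Ω → ℂ) (n : ℕ → Fin M → Ω → ℂ), IsSnapshotModel μ p σsq x n →
      ∀ᵐ ω ∂μ,
        Tendsto (fun N => (sampleCov d d₀ lam θ x n N ω - R).vec) atTop (𝓝 0) ∧
        (∀ᶠ N in atTop,
          (∃ est, IsDAMusic d Mv d₀ lam θ (sampleCov d d₀ lam θ x n N ω) est) ∧
          ∃ est, IsSSMusic d Mv d₀ lam θ (sampleCov d d₀ lam θ x n N ω) est) ∧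
        ∀ est₁ est₂ : ℕ → Fin K → ℝ,
          (∀ᶠ N in atTop,
            IsDAMusic d Mv d₀ lam θ (sampleCov d d₀ lam θ x n N ω) (est₁ N)) →
          (∀ᶠ N in atTop,
            IsSSMusic d Mv d₀ lam θ (sampleCov d d₀ lam θ x n N ω) (est₂ N)) →
          ∀ k,
            FirstOrderEq atTop (fun N => (sampleCov d d₀ lam θ x n N ω - R).vec)
              (fun N => est₁ N k - θ k) (fun N => est₂ N k - θ k) ∧
            FirstOrderEq atTop (fun N => (sampleCov d d₀ lam θ x n N ω - R).vec)
              (fun N => est₂ N k - θ k)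
              (fun N => firstOrderError d Mv d₀ lam θ p k
                (sampleCov d d₀ lam θ x n N ω - R).vec)) := by
  subst hR
  refine ⟨gamma_pos hK hd₀ hlam hθ hθ_range, ?_⟩
  have hne : (𝓝[{H | H.IsHermitian}] (covariance d d₀ lam θ p σsq)).NeBot :=
    mem_closure_iff_nhdsWithin_neBot.1 (subset_closure (covariance_isHermitian d d₀ lam θ p σsq))
  have hmain := estimates_asymptotics hd hMv hK hd₀ hlam hθ hθ_range hp hσ
    (tendsto_id (x := 𝓝[{H | H.IsHermitian}] (covariance d d₀ lam θ p σsq)))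
  refine ⟨hmain.1, hmain.2, fun Ω _ μ _ x n h => ?_⟩
  filter_upwards [ae_tendsto_sampleCov d d₀ lam θ hp hσ h] with ω hω
  obtain ⟨h1, h2⟩ := estimates_asymptotics hd hMv hK hd₀ hlam hθ hθ_range hp hσ hω
  refine ⟨?_, h1, h2⟩
  have hcont : Continuous fun D : Matrix (Fin M) (Fin M) ℂ =>
      (D - covariance d d₀ lam θ p σsq).vec :=
    continuous_pi fun ij => (continuous_id.matrix_elem ij.2 ij.1).sub continuous_const
  simpa [Function.comp_def] using (hcont.tendsto _).comp (hω.mono_right nhdsWithin_le_nhds)
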